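/- Let $E$ be a Euclidean vector space and $\Phi\subset E^*$ a reduced crystallographic root system with coroots $\alpha^\vee\in E$. Fix a system of positive roots $\Phi_+\subset\Phi$, let $\Phi_-=-\Phi_+$, and let $W$ be the Weyl group. Let $P\subset E^*$ be the weight lattice (the lattice dual to the coroot lattice), $H=\mathrm{Hom}_{\mathbb Z}(P,\mathbb C^*)$ the corresponding complex torus, $\mathfrak h=\mathrm{Hom}_{\mathbb Z}(P,\mathbb C)$ its Lie algebra, $e^\lambda$ the function on $H$ given by $\lambda\in P$, and $H_{\mathrm{reg}}=H\setminus\bigcup_{\alpha\in\Phi}\{e^\alpha=1\}$. Let $A$ be an associative unital $\mathbb C$-algebra, $\{t_\alpha\}_{\alpha\in\Phi}\subset A$ elements with $t_{-\alpha}=t_\alpha$, and $\tau:\mathfrak h\to A$ a linear map. Consider the $A$-valued connection on $H_{\mathrm{reg}}$ $$\nabla=d-\sum_{\alpha\in\Phi_+}\frac{d\alpha}{e^\alpha-1}\,t_\alpha-\sum_i du_i\,\tau(u^i),$$ where $\{u_i\}$, $\{u^i\}$ are dual bases of $\mathfrak h^*$ and $\mathfrak h$ and the $du_i$ are regarded as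 translation-invariant one-forms on $H$. For $w\in W$ and $v\in\mathfrak h$ put $$\tau_w(v)=\tau(v)-\sum_{\alpha\in\Phi_+\cap w\Phi_-}\alpha(v)\,t_\alpha,\qquad \delta(v)=\tau(v)-\tfrac12\sum_{\alpha\in\Phi_+}\alpha(v)\,t_\alpha .$$ A root subsystem of $\Phi$ is a subset $\Psi\subset\Phi$ with $\langle\Psi\rangle_{\mathbb Z}\cap\Phi=\Psi$; its rank is the dimension of its real span, and $\Psi_+=\Psi\cap\Phi_+$. 1. The connection $\nabla$ is flat if and only if the following relations hold: - $(tt)$ for any rank 2 root subsystem $\Psi\subset\Phi$ and $\alpha\in\Psi$, $\ [t_\alpha,\sum_{\beta\in\Psi_+}t_\beta]=0$; - $(\tau\tau)$ for any $u,v\in\mathfrak h$, $\ [\tau(u),\tau(v)]=0$; - $(t\tau)$ for any $\alpha\in\Phi_+$, any $w\in W$ such that $w^{-1}\alpha$ is a simple root, and any $u\in\mathfrak h$ with $\alpha(u)=0$, $\ [t_\alpha,\tau_w(u)]=0$. 2. If the relations $(tt)$ hold, then the relations $(t\tau)$ are equivalent to the relations $(t\delta)$: $[t_\alpha,\delta(v)]=0$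 for any $\alpha\in\Phi$ and $v\in\mathfrak h$ with $\alpha(v)=0$. -/

import Mathlib

noncomputable section

namespace TrigConnection

open Module

section Torus

variable {ι M N : Type*} [AddCommGroup M] [Module ℝ M] [AddCommGroup N] [Module ℝ N]

/-- The weight lattice of a root system in `M = E^*` with coroots in `N = E`: the lattice dual to
the coroot lattice, i.e. the vectors whose pairing with every coroot is an integer. -/
def weightLattice (P : RootPairing ι ℝ M N) : AddSubgroup M where
  carrier := {x | ∀ i, ∃ n : ℤ, P.toLinearMap x (P.coroot i) = n}
  zero_mem' := fun _ => ⟨0, by simp⟩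
  add_mem' := by
    intro x y hx hy i
    obtain ⟨m, hm⟩ := hx i
    obtain ⟨n, hn⟩ := hy i
    exact ⟨m + n, by simp [hm, hn]⟩
  neg_mem' := by
    intro x hx i
    obtain ⟨m, hm⟩ := hx i
    exact ⟨-m, by simp [hm]⟩

/-- A root, viewed as an element of the weight lattice. -/
def rootWeight (P : RootPairing ι ℝ M N) [P.IsCrystallographic] (i : ι) : weightLattice P :=
  ⟨P.root i, fun j => by
    obtain ⟨n, hn⟩ := P.exists_value (S := ℤ) i j
    exact ⟨n, by simpa using hn.symm⟩⟩

/-- The complex torus `H` of group homomorphisms from the weight lattice to `ℂˣ`. -/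
abbrev Torus (P : RootPairing ι ℝ M N) : Type _ := Multiplicative (weightLattice P) →* ℂˣ

/-- The Lie algebra `𝔥` of the torus: additive homomorphisms from the weight lattice to `ℂ`. -/
abbrev Cartan (P : RootPairing ι ℝ M N) : Type _ := weightLattice P →+ ℂ

/-- The function `e^w` on the torus attached to a weight `w`. -/
def expWeight {P : RootPairing ι ℝ M N} (w : weightLattice P) (p : Torus P) : ℂ :=
  (p (Multiplicative.ofAdd w) : ℂˣ)

/-- The exponential map of the torus: `e^w (exp X) = exp (X w)` for every weight `w`. -/
def torusExp {P : RootPairing ι ℝ M N} (X : Cartan P) : Torus P where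
  toFun w := Units.mk0 (Complex.exp (X w.toAdd)) (Complex.exp_ne_zero _)
  map_one' := by
    ext
    simp
  map_mul' := by
    intro w w'
    ext
    simp [Complex.exp_add]

/-- The set of regular elements of the torus: no root `α` satisfies `e^α = 1`. -/
def regularSet (P : RootPairing ι ℝ M N) [P.IsCrystallographic] : Set (Torus P) :=
  {p | ∀ i, expWeight (rootWeight P i) p ≠ 1}

/-- The value `α(u)` of the `i`-th root `α` on `u ∈ 𝔥`; it is also the value of the
translation-invariant one-form `dα` on the translation-invariant vector field `u`. -/
def rootEval {P : RootPairing ι ℝ M N} [P.IsCrystallographic] (i : ι) (u : Cartan P) : ℂ :=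
  u (rootWeight P i)

variable {A : Type*} [Ring A] [Algebra ℂ A]

/-- The function `f` has derivative `a` at the point `p` of the torus along the
translation-invariant vector field `u`. As `A` is a bare algebra, possibly of infinite dimension,
the derivative of the curve `s ↦ f (p exp(s u))` is taken after applying linear functionals;
these separate the points of `A`, so that `a` is unique. -/
def HasDerivAlong {P : RootPairing ι ℝ M N} (f : Torus P → A) (u : Cartan P) (p : Torus P)
    (a : A) : Prop :=
  ∀ φ : Dual ℂ A, HasDerivAt (fun s : ℂ => φ (f (p * torusExp (s • u)))) (φ a) 0

/-- The connection `∇ = d - ω` on the trivial bundle with fibre `A`, where the one-form `ω` is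
written in the trivialisation of the tangent bundle of the torus by translation-invariant vector
fields, has curvature `F = -dω + ω ∧ ω` with value `c` on `(u, v)` at `p`. Here
`dω (u, v) = ∂_u (ω v) - ∂_v (ω u)`, since translation-invariant vector fields commute, and
`(ω ∧ ω) (u, v) = [ω u, ω v]`. -/
def HasCurvatureAt {P : RootPairing ι ℝ M N} (ω : Torus P → (Cartan P →ₗ[ℂ] A)) (p : Torus P)
    (u v : Cartan P) (c : A) : Prop :=
  ∃ a b : A, HasDerivAlong (fun q => ω q v) u p a ∧ HasDerivAlong (fun q => ω q u) v p b ∧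
    c = -(a - b) + ⁅ω p u, ω p v⁆

/-- The connection `∇ = d - ω` is flat on `U`: its curvature exists and vanishes there. -/
def IsFlatOn {P : RootPairing ι ℝ M N} (ω : Torus P → (Cartan P →ₗ[ℂ] A))
    (U : Set (Torus P)) : Prop :=
  ∀ p ∈ U, ∀ u v : Cartan P, HasCurvatureAt ω p u v 0

/-- The one-form `∑ u_i τ(u^i)` attached to a linear map `τ`, for dual bases `u_i` of `𝔥^*` and
`u^i` of `𝔥`, is `τ` itself. -/
theorem sum_dual_basis {P : RootPairing ι ℝ M N} {κ : Type*} [Fintype κ] (e : Basis κ ℂ (Cartan P))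
    (τ : Cartan P →ₗ[ℂ] A) : ∑ k, (e.coord k).smulRight (τ (e k)) = τ := by
  ext u
  conv_rhs => rw [← e.sum_repr u, map_sum]
  simp

end Torus

section Relations

variable {ι M N : Type*} [Fintype ι] [AddCommGroup M] [Module ℝ M] [AddCommGroup N] [Module ℝ N]
  {P : RootPairing ι ℝ M N} [P.IsCrystallographic]
  {A : Type*} [Ring A] [Algebra ℂ A]

/-- The one-form `dα` of the `i`-th root `α`, as a linear form on `𝔥`. -/
def dRoot (i : ι) : Cartan P →ₗ[ℂ] ℂ where
  toFun u := rootEval i u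
  map_add' _ _ := rfl
  map_smul' _ _ := rfl

open Classical in
/-- The one-form `∑_{α > 0} dα / (e^α - 1) t_α + ∑ du_i τ(u^i)` of the trigonometric connection,
in the trivialisation by translation-invariant vector fields. Here `α > 0` means positive with
respect to the base `b`. -/
def trigForm (b : P.Base) (t : ι → A) (τ : Cartan P →ₗ[ℂ] A) (p : Torus P) :
    Cartan P →ₗ[ℂ] A :=
  (∑ i with b.IsPos i,
    (expWeight (rootWeight P i) p - 1)⁻¹ • (dRoot i : Cartan P →ₗ[ℂ] ℂ).smulRight (t i)) + τ

open Classical in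
/-- `τ_w (u) = τ(u) - ∑_{α ∈ Φ₊ ∩ w Φ₋} α(u) t_α`. The root `α` lies in `w Φ₋` when `w⁻¹ α` is not
positive. -/
def tauTwist (b : P.Base) (t : ι → A) (τ : Cartan P →ₗ[ℂ] A) (w : P.weylGroup) (u : Cartan P) :
    A :=
  τ u - ∑ i with b.IsPos i ∧ ¬ b.IsPos (P.weylGroupToPerm w⁻¹ i), rootEval i u • t i

open Classical in
/-- `δ(v) = τ(v) - 1/2 ∑_{α > 0} α(v) t_α`. -/
def delta (b : P.Base) (t : ι → A) (τ : Cartan P →ₗ[ℂ] A) (v : Cartan P) : A :=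
  τ v - (1 / 2 : ℂ) • ∑ i with b.IsPos i, rootEval i v • t i

/-- A root subsystem: a set `Ψ` of roots such that every root in the `ℤ`-span of `Ψ` is in `Ψ`. -/
def IsRootSubsystem (P : RootPairing ι ℝ M N) (Ψ : Set ι) : Prop :=
  {i | P.root i ∈ AddSubgroup.closure (P.root '' Ψ)} = Ψ

/-- The rank of a set of roots: the dimension of its real span. -/
def subsystemRank (P : RootPairing ι ℝ M N) (Ψ : Set ι) : ℕ :=
  finrank ℝ (Submodule.span ℝ (P.root '' Ψ))

open Classical in
/-- The relations `(tt)`: `[t_α, ∑_{β ∈ Ψ₊} t_β] = 0` for every root subsystem `Ψ` of rank two and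
every `α ∈ Ψ`. -/
def RelTT (b : P.Base) (t : ι → A) : Prop :=
  ∀ Ψ : Set ι, IsRootSubsystem P Ψ → subsystemRank P Ψ = 2 →
    ∀ i ∈ Ψ, ⁅t i, ∑ j with j ∈ Ψ ∧ b.IsPos j, t j⁆ = 0

/-- The relations `(ττ)`: `[τ(u), τ(v)] = 0` for all `u, v ∈ 𝔥`. -/
def RelTauTau (τ : Cartan P →ₗ[ℂ] A) : Prop :=
  ∀ u v : Cartan P, ⁅τ u, τ v⁆ = 0

/-- The relations `(tτ)`: `[t_α, τ_w(u)] = 0` for every positive root `α`, every `w` in the Weyl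
group such that `w⁻¹ α` is simple, and every `u ∈ 𝔥` with `α(u) = 0`. -/
def RelTTau (b : P.Base) (t : ι → A) (τ : Cartan P →ₗ[ℂ] A) : Prop :=
  ∀ i : ι, b.IsPos i → ∀ w : P.weylGroup, P.weylGroupToPerm w⁻¹ i ∈ b.support →
    ∀ u : Cartan P, rootEval i u = 0 → ⁅t i, tauTwist b t τ w u⁆ = 0

/-- The relations `(tδ)`: `[t_α, δ(v)] = 0` for every root `α` and every `v ∈ 𝔥` with
`α(v) = 0`. -/
def RelTDelta (b : P.Base) (t : ι → A) (τ : Cartan P →ₗ[ℂ] A) : Prop :=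
  ∀ i : ι, ∀ v : Cartan P, rootEval i v = 0 → ⁅t i, delta b t τ v⁆ = 0

end Relations

end TrigConnection

end

noncomputable section

namespace TrigConnection

open Module

/-! ### Root strings and the relations (tt). -/

section RootCombinatorics

variable {ι M N : Type*} [AddCommGroup M] [Module ℝ M] [AddCommGroup N] [Module ℝ N]

/-! The coefficient of dα in the connection form ω depends on e^α alone, so ω is closed and flatness
says that ω(u) and ω(v) commute at each regular point (`isFlatOn_iff`). Since 1/(e^α - 1) + 1/2 is
half of coth(α/2), ω is also the sum of (1/2) coth(α/2) dα t_α over positive roots, plus δ. Each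
summand is invariant under α ↦ -α, so sums over positive roots can be replaced by half-sums over all
roots.

The relations (tt) are used in the equivalent form `RelString`: the brackets [t_α, t_γ] sum to zero
over each string γ ∈ β + ℤα. Hence t_α commutes with any combination of the t_β whose coefficients
are constant on α-strings. This gives the second claim: τ_w - δ is half the sum of β(u) t_β over β ∈
wΦ₊, and if w⁻¹α is simple then wΦ₊ is stable under α-strings, apart from ±α.

Relations imply flatness (`lie_trigForm`). By (tδ) the mixed terms of [ω(u), ω(v)] cancel. Replace
each e^α by e^α w^(ht α). For a point in general position the poles in w are simple, and the string
relations kill the residues, so `sum_mul_mul_eq_of_residues` shows that the expression is constant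
in w. At w = 0 all functions (1/2) coth equal -1/2; their products are those of the constant
coefficients 1/2, for which the form is τ. So the bracket at w = 1 is [τ(u), τ(v)], and continuity
covers the remaining regular points.

Flatness implies the relations by degeneration. Near a point where exactly the roots of ℤα + ℤβ
satisfy e^γ = 1, approached with two different speeds, the rescaled form isolates t_α in one
direction and the other roots of the lattice in another (`relPlane_of_flat`). Near a generic point
of e^α = 1 the leading term is t_α, and the string relations reduce the rest to δ
(`relTDelta_of_flat`). Then (ττ) follows from the constant value of the bracket. -/

/-- Two roots are equivalent modulo the `i`-th root `α` if they differ by an element of `ℤ α`. -/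
def stringSetoid (P : RootPairing ι ℝ M N) (i : ι) : Setoid ι where
  r j k := ∃ n : ℤ, P.root k = P.root j + n • P.root i
  iseqv :=
    { refl := fun j => ⟨0, by simp⟩
      symm := by
        rintro j k ⟨n, hn⟩
        exact ⟨-n, by rw [hn]; module⟩
      trans := by
        rintro j k l ⟨n, hn⟩ ⟨m, hm⟩
        exact ⟨n + m, by rw [hm, hn]; module⟩ }

/-- The roots in the lattice spanned by two given roots. -/
def planeSet (P : RootPairing ι ℝ M N) (i j : ι) : Set ι :=
  {k | ∃ m n : ℤ, P.root k = m • P.root i + n • P.root j}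

lemma root_reflectionPerm_self (P : RootPairing ι ℝ M N) (i : ι) :
    P.root (P.reflectionPerm i i) = -P.root i := by
  rw [P.root_reflectionPerm, P.reflection_apply_self]

lemma isPos_neg_iff {P : RootPairing ι ℝ M N} (b : P.Base) {i j : ι} (h : P.root j = -P.root i) :
    b.IsPos j ↔ ¬ b.IsPos i := by
  have h2 : j = P.reflectionPerm i i := P.root.injective (by rw [h, root_reflectionPerm_self])
  have := RootPairing.Base.IsPos.neg_iff_not b i
  rw [P.indexNeg_neg] at this
  rw [h2, this]

lemma linearIndependent_roots (P : RootPairing ι ℝ M N) [P.IsReduced] {i j : ι}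
    (h : j ≠ i) (h' : P.root j ≠ -P.root i) :
    LinearIndependent ℝ ![P.root i, P.root j] :=
  RootPairing.IsReduced.linearIndependent P h.symm (fun h => h' (by rw [h, neg_neg]))

/-- Coefficients with respect to two independent roots are unique. -/
lemma coeff_ext {P : RootPairing ι ℝ M N} {i j : ι}
    (h : LinearIndependent ℝ ![P.root i, P.root j]) {a b c d : ℝ}
    (he : a • P.root i + b • P.root j = c • P.root i + d • P.root j) : a = c ∧ b = d := by
  rw [LinearIndependent.pair_iff] at h
  have := h (a - c) (b - d) (by
    have h2 := sub_eq_zero.2 he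
    rw [← h2]; module)
  exact ⟨sub_eq_zero.1 this.1, sub_eq_zero.1 this.2⟩

lemma coeff_ext_int {P : RootPairing ι ℝ M N} {i j : ι}
    (h : LinearIndependent ℝ ![P.root i, P.root j]) {a b c d : ℤ}
    (he : a • P.root i + b • P.root j = c • P.root i + d • P.root j) : a = c ∧ b = d := by
  have := coeff_ext h (a := a) (b := b) (c := c) (d := d) (by
    simpa only [Int.cast_smul_eq_zsmul] using he)
  exact_mod_cast this

/-- A string through ±α consists of multiples of α, and in a reduced system these are only ±α. -/
lemma parallel_congr {P : RootPairing ι ℝ M N} [P.IsReduced] {i j k : ι}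
    (h : stringSetoid P i k j) (hj : ¬ (j ≠ i ∧ P.root j ≠ -P.root i)) :
    ¬ (k ≠ i ∧ P.root k ≠ -P.root i) := by
  rintro ⟨h1, h2⟩
  have hli := linearIndependent_roots P h1 h2
  obtain ⟨n, hn⟩ := h
  by_cases hji : j = i
  · subst hji
    have := coeff_ext_int hli (a := 1) (b := 0) (c := n) (d := 1) (by
      rw [one_smul]; nth_rw 1 [hn]; module)
    omega
  · have : P.root j = -P.root i := by tauto
    have := coeff_ext_int hli (a := -1) (b := 0) (c := n) (d := 1) (by
      have h3 := this.symm.trans hn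
      rw [neg_smul, one_smul, zero_smul, add_zero, h3]; module)
    omega

/-- The commutator as a bilinear map. -/
def lieBilin (A : Type*) [Ring A] [Algebra ℂ A] : A →ₗ[ℂ] A →ₗ[ℂ] A :=
  LinearMap.mul ℂ A - (LinearMap.mul ℂ A).flip

lemma lie_eq_lieBilin {A : Type*} [Ring A] [Algebra ℂ A] (x y : A) : ⁅x, y⁆ = lieBilin A x y := rfl

lemma lieBilin_self {A : Type*} [Ring A] [Algebra ℂ A] (x : A) : lieBilin A x x = 0 := by
  simp [lieBilin]

lemma lieBilin_swap {A : Type*} [Ring A] [Algebra ℂ A] (x y : A) :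
    lieBilin A x y = -lieBilin A y x := by
  simp [lieBilin]

variable {A : Type*} [Ring A] [Algebra ℂ A] [Fintype ι]

open Classical in
/-- Sums of `[t_α, t_γ]` over strings `γ ∈ β + ℤ α` vanish. -/
def RelString (P : RootPairing ι ℝ M N) (t : ι → A) : Prop :=
  ∀ i j : ι, ∑ k with stringSetoid P i k j, ⁅t i, t k⁆ = 0

open Classical in
/-- Sums of `[t_α, t_γ]` over roots `γ ∈ ℤ α + ℤ β` vanish. -/
def RelPlane (P : RootPairing ι ℝ M N) (t : ι → A) : Prop :=
  ∀ i j : ι, LinearIndependent ℝ ![P.root i, P.root j] →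
    ∑ k with k ∈ planeSet P i j, ⁅t i, t k⁆ = 0

omit [Fintype ι] in
lemma lie_eq_zero_of_parallel {P : RootPairing ι ℝ M N} {t : ι → A}
    (ht : ∀ i j, P.root j = -P.root i → t j = t i) {i j : ι}
    (h : ¬ (j ≠ i ∧ P.root j ≠ -P.root i)) : ⁅t i, t j⁆ = 0 := by
  by_cases hj : j = i
  · subst hj; rw [lie_eq_lieBilin, lieBilin_self]
  · have : P.root j = -P.root i := by tauto
    rw [ht i j this, lie_eq_lieBilin, lieBilin_self]

-- Reindexing by γ ↦ -γ.
open Classical in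
lemma sum_neg_reindex_of_eq (P : RootPairing ι ℝ M N) {B : Type*} [AddCommMonoid B] (F G : ι → B)
    (p q : ι → Prop) (hpq : ∀ i j, P.root j = -P.root i → (p i ↔ q j))
    (hF : ∀ i j, P.root j = -P.root i → F i = G j) :
    ∑ k with p k, F k = ∑ k with q k, G k := by
  have hr := root_reflectionPerm_self P
  refine Finset.sum_bij' (fun k _ => P.reflectionPerm k k) (fun k _ => P.reflectionPerm k k)
    ?_ ?_ ?_ ?_ ?_
  · intro k hk
    simpa using (hpq k _ (hr k)).1 (by simpa using hk)
  · intro k hk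
    simpa using (hpq _ k (by rw [hr, neg_neg])).2 (by simpa using hk)
  · intro k hk
    apply P.root.injective
    rw [hr, hr, neg_neg]
  · intro k hk
    apply P.root.injective
    rw [hr, hr, neg_neg]
  · intro k hk
    exact hF k _ (hr k)

open Classical in
lemma sum_neg_reindex (P : RootPairing ι ℝ M N) {B : Type*} [AddCommMonoid B] (F : ι → B)
    (p q : ι → Prop) (hpq : ∀ i j, P.root j = -P.root i → (p i ↔ q j))
    (hF : ∀ i j, P.root j = -P.root i → F j = F i) :
    ∑ k with p k, F k = ∑ k with q k, F k :=
  sum_neg_reindex_of_eq P F F p q hpq fun i j h => (hF i j h).symm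

-- Induction on the number of roots in ℤα + ℤβ. This set splits into the strings of β and -β, which
-- contribute equally because t is even, and strings of roots aα + cβ with c ≠ ±1. The latter vanish
-- by induction, since ℤα + cℤβ misses β. So twice the sum over the string of β is zero.
open Classical in
theorem relString_of_relPlane (P : RootPairing ι ℝ M N) [P.IsReduced] {t : ι → A}
    (ht : ∀ i j, P.root j = -P.root i → t j = t i) (H : RelPlane P t) : RelString P t := by
  intro i
  suffices hs : ∀ n : ℕ, ∀ j, (Finset.univ.filter (· ∈ planeSet P i j)).card = n →
      ∑ k with stringSetoid P i k j, ⁅t i, t k⁆ = 0 from fun j => hs _ j rfl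
  intro n
  induction n using Nat.strong_induction_on with
  | _ n ih =>
  intro j hcard
  by_cases hj : j ≠ i ∧ P.root j ≠ -P.root i
  swap
  · refine Finset.sum_eq_zero fun k hk => lie_eq_zero_of_parallel ht ?_
    exact parallel_congr (by simpa using hk) hj
  have hli := linearIndependent_roots P hj.1 hj.2
  have hsum := H i j hli
  have hopp : ∑ k with (∃ m : ℤ, P.root k = m • P.root i - P.root j), ⁅t i, t k⁆ =
      ∑ k with stringSetoid P i k j, ⁅t i, t k⁆ := by
    refine sum_neg_reindex P _ _ _ ?_ fun k l h => by rw [ht k l h]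
    intro k l h
    constructor
    · rintro ⟨m, hm⟩
      exact ⟨m, by rw [h, hm]; module⟩
    · rintro ⟨m, hm⟩
      refine ⟨m, ?_⟩
      rw [h] at hm
      rw [hm]; module
  have hrest : ∑ k with (k ∈ planeSet P i j ∧ ¬ stringSetoid P i k j ∧
      ¬ ∃ m : ℤ, P.root k = m • P.root i - P.root j), ⁅t i, t k⁆ = 0 := by
    refine Finset.sum_cancels_of_partition_cancels (stringSetoid P i) ?_
    intro l hl
    simp only [Finset.mem_filter, Finset.mem_univ, true_and] at hl
    obtain ⟨⟨a, c, hac⟩, hl1, hl2⟩ := hl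
    have hfil : (Finset.univ.filter (fun k => (k ∈ planeSet P i j ∧ ¬ stringSetoid P i k j ∧
      ¬ ∃ m : ℤ, P.root k = m • P.root i - P.root j))).filter (fun k => stringSetoid P i k l) =
        Finset.univ.filter (fun k => stringSetoid P i k l) := by
      ext k
      simp only [Finset.mem_filter, Finset.mem_univ, true_and, and_iff_right_iff_imp]
      rintro ⟨m, hm⟩
      refine ⟨⟨a - m, c, ?_⟩, fun h => hl1 ?_, fun ⟨m', hm'⟩ => hl2 ⟨m + m', ?_⟩⟩
      · rw [hac] at hm
        rw [← sub_eq_iff_eq_add] at hm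
        rw [← hm]; module
      · exact (stringSetoid P i).trans ((stringSetoid P i).symm ⟨m, hm⟩) h
      · rw [hm, hm']; module
    rw [hfil]
    -- For c = 0 the string lies in {α, -α} and every bracket vanishes.
    by_cases hc0 : c = 0
    · refine Finset.sum_eq_zero fun k hk => lie_eq_zero_of_parallel ht ?_
      refine parallel_congr (by simpa using hk) fun h => ?_
      have h2 := linearIndependent_roots P h.1 h.2
      rw [LinearIndependent.pair_iff] at h2
      simpa using h2 a (-1) (by rw [hac, hc0, Int.cast_smul_eq_zsmul]; module)
    refine ih _ ?_ l rfl
    rw [← hcard]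
    refine Finset.card_lt_card ⟨fun k hk => ?_, fun hsub => ?_⟩
    · simp only [Finset.mem_filter, Finset.mem_univ, true_and] at hk ⊢
      obtain ⟨m, m', hm⟩ := hk
      exact ⟨m + m' * a, m' * c, by rw [hm, hac]; module⟩
    · have hjm : j ∈ Finset.univ.filter (· ∈ planeSet P i l) := hsub (by
        simpa using ⟨0, 1, by module⟩)
      simp only [Finset.mem_filter, Finset.mem_univ, true_and] at hjm
      obtain ⟨m, m', hm⟩ := hjm
      -- If β belonged to the smaller lattice, c would be a unit, and the string would be that of β
      -- or -β, both excluded.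
      have h3 := (coeff_ext_int hli (a := 0) (b := 1) (c := m + m' * a) (d := m' * c) (by
        rw [zero_smul, zero_add, one_smul]; conv_lhs => rw [hm, hac]
        module)).2
      rcases Int.isUnit_iff.1 (IsUnit.of_mul_eq_one _ ((mul_comm _ _).trans h3.symm)) with h4 | h4
      · exact hl1 ⟨-a, by rw [hac, h4]; module⟩
      · exact hl2 ⟨a, by rw [hac, h4]; module⟩
  have hsplit : ∑ k with k ∈ planeSet P i j, ⁅t i, t k⁆ =
      ∑ k with stringSetoid P i k j, ⁅t i, t k⁆ +
      ((∑ k with (∃ m : ℤ, P.root k = m • P.root i - P.root j), ⁅t i, t k⁆) +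
      ∑ k with (k ∈ planeSet P i j ∧ ¬ stringSetoid P i k j ∧
      ¬ ∃ m : ℤ, P.root k = m • P.root i - P.root j), ⁅t i, t k⁆) := by
    simp only [Finset.sum_filter, ← Finset.sum_add_distrib]
    refine Finset.sum_congr rfl fun k _ => ?_
    by_cases h1 : stringSetoid P i k j
    · have h2 : ¬ ∃ m : ℤ, P.root k = m • P.root i - P.root j := by
        rintro ⟨m, hm⟩
        obtain ⟨n, hn⟩ := h1
        have := (coeff_ext_int hli (a := 0) (b := 1) (c := m + n) (d := -1) (by
          rw [zero_smul, zero_add, one_smul]; conv_lhs => rw [hn, hm]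
          module)).2
        omega
      have h3 : k ∈ planeSet P i j := by
        obtain ⟨n, hn⟩ := h1
        exact ⟨-n, 1, by rw [hn]; module⟩
      simp [h1, h2, h3]
    · by_cases h2 : ∃ m : ℤ, P.root k = m • P.root i - P.root j
      · have h3 : k ∈ planeSet P i j := by
          obtain ⟨n, hn⟩ := h2
          exact ⟨n, -1, by rw [hn]; module⟩
        simp [h1, h2, h3]
      · simp [h1, h2]
  rw [hsplit, hopp, hrest, add_zero, ← two_nsmul] at hsum
  have : (2 : ℂ) • ∑ k with stringSetoid P i k j, ⁅t i, t k⁆ = 0 := by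
    rw [← hsum, two_smul, two_nsmul]
  exact (smul_eq_zero.1 this).resolve_left (by norm_num)

-- A set closed under α-strings is a disjoint union of them.
omit [Algebra ℂ A] in
open Classical in
theorem sum_lie_eq_zero_of_stringClosed {P : RootPairing ι ℝ M N} {t : ι → A}
    (H : RelString P t) (i : ι) (p : ι → Prop) (hp : ∀ j k, stringSetoid P i j k → p k → p j) :
    ∑ k with p k, ⁅t i, t k⁆ = 0 := by
  refine Finset.sum_cancels_of_partition_cancels (stringSetoid P i) fun l hl => ?_
  rw [← H i l, Finset.filter_filter]
  refine Finset.sum_congr ?_ fun _ _ => rfl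
  ext k
  simp only [Finset.mem_filter, Finset.mem_univ, true_and, and_iff_right_iff_imp]
  exact fun h => hp _ _ h (by simpa using hl)

open Classical in
/-- If coefficients are constant on the strings `β + ℤ α`, the corresponding combination of the
`t_β` commutes with `t_α`. -/
theorem lie_sum_eq_zero_of_string {P : RootPairing ι ℝ M N} [P.IsReduced] {t : ι → A}
    (ht : ∀ i j, P.root j = -P.root i → t j = t i) (H : RelString P t) (i : ι) (c : ι → ℂ)
    (hc : ∀ j k, k ≠ i → P.root k ≠ -P.root i → stringSetoid P i j k → c j = c k) :
    ∑ k, c k • ⁅t i, t k⁆ = 0 := by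
  refine Finset.sum_cancels_of_partition_cancels (stringSetoid P i) fun l _ => ?_
  by_cases hl : l ≠ i ∧ P.root l ≠ -P.root i
  · have : ∀ k ∈ Finset.univ.filter (fun k => stringSetoid P i k l),
        c k • ⁅t i, t k⁆ = c l • ⁅t i, t k⁆ := by
      intro k hk
      rw [hc k l hl.1 hl.2 (by simpa using hk)]
    rw [Finset.sum_congr rfl this, ← Finset.smul_sum, H i l, smul_zero]
  · refine Finset.sum_eq_zero fun k hk => ?_
    rw [lie_eq_zero_of_parallel ht (parallel_congr (by simpa using hk) hl), smul_zero]

open Classical in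
lemma sum_eq_two_smul_sum_pos (P : RootPairing ι ℝ M N) (b : P.Base) (F : ι → A)
    (hF : ∀ i j, P.root j = -P.root i → F j = F i) (p : ι → Prop)
    (hp : ∀ i j, P.root j = -P.root i → (p i ↔ p j)) :
    ∑ k with p k, F k = (2 : ℂ) • ∑ k with p k ∧ b.IsPos k, F k := by
  have h1 : ∑ k with p k ∧ b.IsPos k, F k = ∑ k with p k ∧ ¬ b.IsPos k, F k := by
    convert! sum_neg_reindex P F (fun k => p k ∧ b.IsPos k) (fun k => p k ∧ ¬ b.IsPos k) (by
      intro i j h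
      rw [← hp i j h, isPos_neg_iff b h, not_not]) hF
  rw [two_smul]
  nth_rw 2 [h1]
  simp only [Finset.sum_filter, ← Finset.sum_add_distrib]
  refine Finset.sum_congr rfl fun k _ => ?_
  by_cases hk : p k <;> by_cases hk' : b.IsPos k <;> simp [hk, hk']

/-- The relations `(tt)` are the relations attached to root strings. -/
theorem relTT_iff_relString {P : RootPairing ι ℝ M N} [P.IsReduced] [P.IsCrystallographic]
    (b : P.Base) {t : ι → A} (ht : ∀ i j, P.root j = -P.root i → t j = t i) :
    RelTT b t ↔ RelString P t := by
  classical
  have key : ∀ i (Ψ : Set ι), (∀ j k, P.root k = -P.root j → (j ∈ Ψ ↔ k ∈ Ψ)) →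
      ∑ k with k ∈ Ψ, ⁅t i, t k⁆ = (2 : ℂ) • ⁅t i, ∑ k with k ∈ Ψ ∧ b.IsPos k, t k⁆ := by
    intro i Ψ hΨ
    rw [sum_eq_two_smul_sum_pos P b _ (fun k l h => by rw [ht k l h]) _ hΨ]
    simp only [lie_eq_lieBilin, map_sum]
  constructor
  · intro H
    refine relString_of_relPlane P ht fun i j hij => ?_
    have hspan : AddSubgroup.closure (P.root '' planeSet P i j) =
        AddSubgroup.closure {P.root i, P.root j} := by
      apply le_antisymm
      · rw [AddSubgroup.closure_le]
        rintro - ⟨k, ⟨m, n, hk⟩, rfl⟩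
        exact AddSubgroup.mem_closure_pair.2 ⟨m, n, hk.symm⟩
      · apply AddSubgroup.closure_mono
        rintro - (rfl | rfl)
        · exact ⟨i, ⟨1, 0, by module⟩, rfl⟩
        · exact ⟨j, ⟨0, 1, by module⟩, rfl⟩
    have hi : i ∈ planeSet P i j := ⟨1, 0, by module⟩
    have hj : j ∈ planeSet P i j := ⟨0, 1, by module⟩
    have hneg : ∀ k l, P.root l = -P.root k → (k ∈ planeSet P i j ↔ l ∈ planeSet P i j) := by
      intro k l h
      constructor
      · rintro ⟨m, n, hk⟩
        exact ⟨-m, -n, by rw [h, hk]; module⟩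
      · rintro ⟨m, n, hk⟩
        rw [h] at hk
        exact ⟨-m, -n, by rw [← neg_neg (P.root k), hk]; module⟩
    have hsub : IsRootSubsystem P (planeSet P i j) := by
      unfold IsRootSubsystem
      rw [hspan]
      ext k
      rw [Set.mem_ofPred_eq, AddSubgroup.mem_closure_pair]
      simp only [planeSet, Set.mem_ofPred_eq, eq_comm]
    have hrank : subsystemRank P (planeSet P i j) = 2 := by
      unfold subsystemRank
      have : Submodule.span ℝ (P.root '' planeSet P i j) =
          Submodule.span ℝ (Set.range ![P.root i, P.root j]) := by
        apply le_antisymm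
        · rw [Submodule.span_le]
          rintro - ⟨k, ⟨m, n, hk⟩, rfl⟩
          rw [SetLike.mem_coe, hk]
          refine add_mem (zsmul_mem (Submodule.subset_span (Set.mem_range_self (0 : Fin 2))) _)
            (zsmul_mem (Submodule.subset_span (Set.mem_range_self (1 : Fin 2))) _)
        · apply Submodule.span_mono
          rintro - ⟨l, rfl⟩
          fin_cases l
          · exact ⟨i, hi, rfl⟩
          · exact ⟨j, hj, rfl⟩
      rw [this, finrank_span_eq_card hij, Fintype.card_fin]
    rw [key i _ hneg]
    convert! smul_zero (2 : ℂ)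
    convert! H _ hsub hrank i hi
  -- A subsystem containing α is closed under α-strings, whatever its rank.
  · intro H Ψ hΨ _ i hi
    have hneg : ∀ j k, P.root k = -P.root j → j ∈ Ψ → k ∈ Ψ := by
      intro j k h hj
      rw [← hΨ, Set.mem_ofPred_eq, h]
      exact neg_mem (AddSubgroup.subset_closure (Set.mem_image_of_mem _ hj))
    have h2 : ∑ k with k ∈ Ψ, ⁅t i, t k⁆ = _ :=
      key i Ψ fun j k h => ⟨hneg j k h, hneg k j (by rw [h, neg_neg])⟩
    rw [sum_lie_eq_zero_of_stringClosed H i (· ∈ Ψ)] at h2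
    · exact (smul_eq_zero.1 h2.symm).resolve_left two_ne_zero
    · rintro j k ⟨n, hn⟩ hk
      rw [← hΨ, Set.mem_ofPred_eq, ← sub_eq_iff_eq_add.2 hn]
      exact sub_mem (AddSubgroup.subset_closure (Set.mem_image_of_mem _ hk))
        (zsmul_mem (AddSubgroup.subset_closure (Set.mem_image_of_mem _ hi)) _)

end RootCombinatorics

/-! ### Equivalence of (tτ) and (tδ). -/

section WeylTwist

variable {ι M N : Type*} [AddCommGroup M] [Module ℝ M] [AddCommGroup N] [Module ℝ N]
  {P : RootPairing ι ℝ M N} [P.IsCrystallographic]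

lemma rootEval_add_zsmul {i j k : ι} {n : ℤ} (h : P.root k = P.root j + n • P.root i)
    (u : Cartan P) : rootEval k u = rootEval j u + n * rootEval i u := by
  have : rootWeight P k = rootWeight P j + n • rootWeight P i := by
    ext
    simpa [rootWeight] using h
  simp [rootEval, this]

lemma rootEval_neg {i j : ι} (h : P.root j = -P.root i) (u : Cartan P) :
    rootEval j u = -rootEval i u := by
  have : rootWeight P j = -rootWeight P i := by
    ext
    simpa [rootWeight] using h
  simp [rootEval, this]

lemma rootEval_smul {i : ι} (a : ℂ) (v : Cartan P) : rootEval i (a • v) = a * rootEval i v := rfl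

omit [P.IsCrystallographic] in
lemma root_weylGroupToPerm_add_zsmul {i j k : ι} {n : ℤ} (w : P.weylGroup)
    (h : P.root k = P.root j + n • P.root i) :
    P.root (P.weylGroupToPerm w k) =
      P.root (P.weylGroupToPerm w j) + n • P.root (P.weylGroupToPerm w i) := by
  simp only [← P.weylGroup_apply_root, h]
  rw [smul_add, smul_comm w n]

omit [P.IsCrystallographic] in
lemma root_weylGroupToPerm_neg {i j : ι} (w : P.weylGroup) (h : P.root j = -P.root i) :
    P.root (P.weylGroupToPerm w j) = -P.root (P.weylGroupToPerm w i) := by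
  simp only [← P.weylGroup_apply_root, h, smul_neg]

lemma exists_weylGroupToPerm_mem_support [Finite ι] [P.IsReduced] (b : P.Base) {i : ι}
    (hi : b.IsPos i) : ∃ w : P.weylGroup, P.weylGroupToPerm w⁻¹ i ∈ b.support := by
  suffices h : ∃ w : P.weylGroup, P.weylGroupToPerm w i ∈ b.support by
    obtain ⟨w, hw⟩ := h
    exact ⟨w⁻¹, by rwa [inv_inv]⟩
  refine hi.induction_on_reflect
    (p := fun j => ∃ w : P.weylGroup, P.weylGroupToPerm w j ∈ b.support)
    (fun j hj => ⟨1, by simpa using hj⟩) ?_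
  rintro k j ⟨w, hw⟩ _
  refine ⟨w * RootPairing.weylGroup.ofIdx P j, ?_⟩
  have h1 : P.weylGroupToPerm (RootPairing.weylGroup.ofIdx P j) = P.reflectionPerm j :=
    RootPairing.Equiv.reflection_indexEquiv P j
  rw [map_mul, h1, Equiv.Perm.mul_apply, P.reflectionPerm_self]
  exact hw

variable [Fintype ι] {A : Type*} [Ring A] [Algebra ℂ A]

-- Both Φ₊ and wΦ₊ contain Φ₊ ∩ wΦ₊. What remains is Φ₊ ∩ wΦ₋ in the first and its negative in the
-- second, and β(u) t_β is odd in β.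
open Classical in
lemma tauTwist_eq (b : P.Base) {t : ι → A} (ht : ∀ i j, P.root j = -P.root i → t j = t i)
    (τ : Cartan P →ₗ[ℂ] A) (w : P.weylGroup) (u : Cartan P) :
    tauTwist b t τ w u = delta b t τ u + (1 / 2 : ℂ) •
      ∑ k with b.IsPos (P.weylGroupToPerm w⁻¹ k), rootEval k u • t k := by
  set Q : ι → Prop := fun k => b.IsPos (P.weylGroupToPerm w⁻¹ k) with hQ
  set F : ι → A := fun k => rootEval k u • t k with hF
  have h1 : ∑ k with (Q k ∧ ¬ b.IsPos k), F k = ∑ k with (b.IsPos k ∧ ¬ Q k), -F k := by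
    convert! sum_neg_reindex_of_eq P F (-F) (fun k => Q k ∧ ¬ b.IsPos k)
      (fun k => b.IsPos k ∧ ¬ Q k) ?_ ?_
    · intro i j h
      have h2 : Q j ↔ ¬ Q i := isPos_neg_iff b (root_weylGroupToPerm_neg w⁻¹ h)
      rw [isPos_neg_iff b h, h2, not_not, and_comm]
    · intro i j h
      simp [hF, rootEval_neg h, ht i j h]
  have h2 : ∑ k with Q k, F k = ∑ k with (b.IsPos k ∧ Q k), F k +
      ∑ k with (Q k ∧ ¬ b.IsPos k), F k := by
    simp only [Finset.sum_filter, ← Finset.sum_add_distrib]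
    refine Finset.sum_congr rfl fun k _ => ?_
    by_cases hk : Q k <;> by_cases hk' : b.IsPos k <;> simp [hk, hk']
  have h3 : ∑ k with b.IsPos k, F k = ∑ k with (b.IsPos k ∧ Q k), F k +
      ∑ k with (b.IsPos k ∧ ¬ Q k), F k := by
    simp only [Finset.sum_filter, ← Finset.sum_add_distrib]
    refine Finset.sum_congr rfl fun k _ => ?_
    by_cases hk : Q k <;> by_cases hk' : b.IsPos k <;> simp [hk, hk']
  have h4 : tauTwist b t τ w u = τ u - ∑ k with (b.IsPos k ∧ ¬ Q k), F k := rfl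
  have h5 : delta b t τ u = τ u - (1 / 2 : ℂ) • ∑ k with b.IsPos k, F k := rfl
  rw [h4, h5, h2, h3, h1, Finset.sum_neg_distrib]
  module

/-- The difference between τ_w and δ is a combination of the t_β with coefficients constant on
α-strings: β(u) because α(u) = 0, and membership in wΦ₊ because w⁻¹α is simple. -/
lemma lie_tauTwist_eq [P.IsReduced] (b : P.Base) {t : ι → A}
    (ht : ∀ i j, P.root j = -P.root i → t j = t i) (H : RelString P t)
    (τ : Cartan P →ₗ[ℂ] A) (w : P.weylGroup) {i : ι} (hi : P.weylGroupToPerm w⁻¹ i ∈ b.support)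
    {u : Cartan P} (hu : rootEval i u = 0) :
    ⁅t i, tauTwist b t τ w u⁆ = ⁅t i, delta b t τ u⁆ := by
  classical
  have h := lie_sum_eq_zero_of_string ht H i
    (fun k => if b.IsPos (P.weylGroupToPerm w⁻¹ k) then rootEval k u else 0) (by
      intro j k hk hk' hjk
      have hjpar := parallel_congr ((stringSetoid P i).symm hjk)
      have hj : j ≠ i := (not_not.1 (fun h => hjpar h ⟨hk, hk'⟩)).1
      have hjk' := (stringSetoid P i).symm hjk
      obtain ⟨n, hn⟩ := hjk
      obtain ⟨m, hm⟩ := hjk'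
      -- A positive root other than a given simple root stays positive when a multiple of that
      -- simple root is added, as long as the result is a root.
      have hiff : b.IsPos (P.weylGroupToPerm w⁻¹ j) ↔ b.IsPos (P.weylGroupToPerm w⁻¹ k) :=
        ⟨fun h => h.add_zsmul (by simpa using hj) hi (root_weylGroupToPerm_add_zsmul w⁻¹ hn),
         fun h => h.add_zsmul (by simpa using hk) hi (root_weylGroupToPerm_add_zsmul w⁻¹ hm)⟩
      simp only [hiff]
      rw [rootEval_add_zsmul hn, hu, mul_zero, add_zero])
  rw [tauTwist_eq b ht]
  simp only [lie_eq_lieBilin, map_add, map_smul, map_sum, Finset.sum_filter] at h ⊢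
  rw [add_eq_left]
  convert! smul_zero (1 / 2 : ℂ)
  refine Eq.trans (Finset.sum_congr rfl fun k _ => ?_) h
  split_ifs <;> simp

theorem relTTau_iff_relTDelta [P.IsReduced] (b : P.Base) {t : ι → A}
    (ht : ∀ i j, P.root j = -P.root i → t j = t i) (H : RelString P t)
    (τ : Cartan P →ₗ[ℂ] A) : RelTTau b t τ ↔ RelTDelta b t τ := by
  constructor
  · intro h
    have hpos : ∀ i, b.IsPos i → ∀ v : Cartan P, rootEval i v = 0 → ⁅t i, delta b t τ v⁆ = 0 := by
      intro i hi v hv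
      obtain ⟨w, hw⟩ := exists_weylGroupToPerm_mem_support b hi
      rw [← lie_tauTwist_eq b ht H τ w hw hv]
      exact h i hi w hw v hv
    intro i v hv
    by_cases hi : b.IsPos i
    · exact hpos i hi v hv
    · have hr := root_reflectionPerm_self P i
      rw [← ht i _ hr]
      refine hpos _ ((isPos_neg_iff b hr).2 hi) v ?_
      rw [rootEval_neg hr, hv, neg_zero]
  · intro h i _ w hw u hu
    rw [lie_tauTwist_eq b ht H τ w hw hu]
    exact h i u hu

end WeylTwist

/-! ### A rational function without poles. -/

section RationalIdentity

open Polynomial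

lemma X_pow_sub_C_dvd_of_eval_eq_zero {n : ℕ} (hn : 0 < n) {c : ℂ} (hc : c ≠ 0) {p : ℂ[X]}
    (hp : ∀ w : ℂ, w ^ n = c → p.eval w = 0) : X ^ n - C c ∣ p := by
  by_cases hp0 : p = 0
  · simp [hp0]
  have hsep : (X ^ n - C c : ℂ[X]).Separable :=
    separable_X_pow_sub_C c (by exact_mod_cast hn.ne') hc
  refine (IsAlgClosed.splits _).dvd_of_roots_le_roots (monic_X_pow_sub_C c hn.ne').ne_zero ?_
  rw [Multiset.le_iff_subset (nodup_roots hsep)]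
  intro w hw
  rw [mem_roots (monic_X_pow_sub_C c hn.ne').ne_zero, IsRoot.def] at hw
  rw [mem_roots hp0]
  exact hp w (by simpa [sub_eq_zero] using hw)

lemma isCoprime_X_pow_sub_C {n m : ℕ} {c d : ℂ} (h : c ^ m ≠ d ^ n) :
    IsCoprime (X ^ n - C c : ℂ[X]) (X ^ m - C d) := by
  rw [Polynomial.isCoprime_iff_aeval_ne_zero_of_isAlgClosed ℂ ℂ]
  intro w
  by_contra! hw
  apply h
  have h1 : w ^ n = c := by simpa [sub_eq_zero] using hw.1
  have h2 : w ^ m = d := by simpa [sub_eq_zero] using hw.2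
  rw [← h1, ← h2, ← pow_mul, ← pow_mul, mul_comm]

/-- A bilinear expression in the functions `(w ^ n + c) / (2 (w ^ n - c))` all of whose residues
vanish is constant. -/
theorem sum_mul_mul_eq_of_residues {ι : Type*} [DecidableEq ι] (S : Finset ι) (n : ι → ℕ)
    (hn : ∀ i ∈ S, 0 < n i)
    (c : ι → ℂ) (hc : ∀ i ∈ S, c i ≠ 0)
    (hgen : ∀ i ∈ S, ∀ j ∈ S, i ≠ j → c i ^ n j ≠ c j ^ n i)
    (K : ι → ι → ℂ) (hK : ∀ i j, K i j = K j i) (hK0 : ∀ i, K i i = 0)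
    (G : ι → ℂ → ℂ) (hG : ∀ i w, G i w = (w ^ n i + c i) / (2 * (w ^ n i - c i)))
    (hres : ∀ i ∈ S, ∀ w, w ^ n i = c i → ∑ j ∈ S, K i j * G j w = 0)
    (w : ℂ) (hw : ∀ i ∈ S, w ^ n i ≠ c i) :
    ∑ i ∈ S, ∑ j ∈ S, K i j * (G i w * G j w) = ∑ i ∈ S, ∑ j ∈ S, K i j * (1 / 2 * (1 / 2)) := by
  set d : ι → ℂ[X] := fun i => X ^ n i - C (c i) with hd
  set h : ι → ℂ[X] := fun i => C (1 / 2) * (X ^ n i + C (c i)) with hh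
  set T : ι → ι → ℂ[X] := fun i j => h i * h j * ∏ k ∈ (S.erase i).erase j, d k with hT
  set Q : ℂ[X] := ∑ i ∈ S, ∑ j ∈ S, C (K i j) * T i j with hQ
  set D : ℂ[X] := ∏ k ∈ S, d k with hD
  have hde : ∀ i w, (d i).eval w = w ^ n i - c i := by simp [hd]
  have hhe : ∀ i w, (d i).eval w ≠ 0 → (h i).eval w = (d i).eval w * G i w := by
    intro i w hw
    rw [hde] at hw ⊢
    rw [hG]
    simp only [hh, eval_mul, eval_C, eval_add, eval_pow, eval_X]
    field_simp
  have hdne : ∀ i w, w ^ n i ≠ c i → (d i).eval w ≠ 0 := by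
    intro i w hw
    rw [hde]
    exact sub_ne_zero.2 hw
  have hTsym : ∀ i j, T i j = T j i := by
    intro i j
    simp only [hT]
    rw [Finset.erase_right_comm, mul_comm (h i)]
  -- evaluation away from the zeros of the denominators
  have hQe : ∀ w, (∀ i ∈ S, w ^ n i ≠ c i) →
      Q.eval w = (∑ i ∈ S, ∑ j ∈ S, K i j * (G i w * G j w)) * D.eval w := by
    intro w hw
    simp only [hQ, eval_finsetSum, Finset.sum_mul]
    refine Finset.sum_congr rfl fun i hi => Finset.sum_congr rfl fun j hj => ?_
    by_cases hij : i = j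
    · subst hij
      simp [hK0]
    have h1 : D = d i * (d j * ∏ k ∈ (S.erase i).erase j, d k) := by
      rw [Finset.mul_prod_erase _ _ (Finset.mem_erase.2 ⟨Ne.symm hij, hj⟩),
        Finset.mul_prod_erase _ _ hi]
    rw [h1]
    simp only [hT, eval_mul, eval_C]
    rw [hhe i w (hdne i w (hw i hi)), hhe j w (hdne j w (hw j hj))]
    ring
  -- vanishing at the zeros of the denominators
  have hQ0 : ∀ i ∈ S, ∀ w, w ^ n i = c i → Q.eval w = 0 := by
    intro i hi w hwi
    have hother : ∀ j ∈ S, j ≠ i → w ^ n j ≠ c j := by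
      intro j hj hji hwj
      apply hgen i hi j hj hji.symm
      rw [← hwi, ← hwj, ← pow_mul, ← pow_mul, mul_comm]
    have hdi : (d i).eval w = 0 := by rw [hde, hwi, sub_self]
    have hT0 : ∀ j k, j ≠ i → k ≠ i → (T j k).eval w = 0 := by
      intro j k hj hk
      have : i ∈ (S.erase j).erase k := by simp [hi, hj.symm, hk.symm]
      simp only [hT, eval_mul, eval_prod]
      rw [Finset.prod_eq_zero this hdi, mul_zero]
    have hTi : ∑ j ∈ S, K i j * (T i j).eval w = 0 := by
      have : ∀ j ∈ S, K i j * (T i j).eval w =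
          (h i).eval w * (∏ k ∈ S.erase i, (d k).eval w) * (K i j * G j w) := by
        intro j hj
        by_cases hji : j = i
        · subst hji
          simp [hK0]
        rw [← Finset.mul_prod_erase _ _ (Finset.mem_erase.2 ⟨hji, hj⟩)]
        simp only [hT, eval_mul, eval_prod]
        rw [hhe j w (hdne j w (hother j hj hji))]
        ring
      rw [Finset.sum_congr rfl this, ← Finset.mul_sum, hres i hi w hwi, mul_zero]
    simp only [hQ, eval_finsetSum, eval_mul, eval_C]
    rw [← Finset.add_sum_erase _ _ hi, hTi, zero_add]
    have : ∀ j ∈ S.erase i, ∑ k ∈ S, K j k * (T j k).eval w = K i j * (T i j).eval w := by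
      intro j hj
      rw [Finset.sum_eq_single i]
      · rw [hK j i, hTsym j i]
      · intro k _ hk
        rw [hT0 j k (Finset.ne_of_mem_erase hj) hk, mul_zero]
      · exact fun h => absurd hi h
    rw [Finset.sum_congr rfl this]
    rw [← Finset.add_sum_erase _ _ hi, hK0, zero_mul, zero_add] at hTi
    exact hTi
  -- Q/D is the given expression. Each factor of D is separable and Q vanishes at its roots;
  -- distinct factors are coprime by `hgen`.
  have hdvd : D ∣ Q := by
    refine Finset.prod_dvd_of_coprime ?_ fun i hi =>
      X_pow_sub_C_dvd_of_eval_eq_zero (hn i hi) (hc i hi) (hQ0 i hi)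
    intro i hi j hj hij
    exact isCoprime_X_pow_sub_C (hgen i hi j hj hij)
  have hmon : ∀ i ∈ S, (d i).Monic := fun i hi => monic_X_pow_sub_C _ (hn i hi).ne'
  have hDmon : D.Monic := monic_prod_of_monic _ _ hmon
  have hdd : ∀ i, (d i).natDegree = n i := fun i => natDegree_X_pow_sub_C
  have hDdeg : D.natDegree = ∑ i ∈ S, n i := by
    rw [hD, natDegree_prod_of_monic _ _ hmon]
    exact Finset.sum_congr rfl fun i _ => hdd i
  have hhd : ∀ i, (h i).natDegree ≤ n i := fun i =>
    (natDegree_C_mul_le _ _).trans (natDegree_X_pow_add_C).le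
  -- Each term of Q replaces two factors `d` of D by `h` of no larger degree, so the expression is
  -- bounded at infinity.
  have hQdeg : Q.natDegree ≤ D.natDegree := by
    rw [hDdeg]
    refine natDegree_sum_le_of_forall_le _ _ fun i hi =>
      natDegree_sum_le_of_forall_le _ _ fun j hj => ?_
    by_cases hij : i = j
    · subst hij
      simp [hK0]
    refine (natDegree_C_mul_le _ _).trans ?_
    rw [← Finset.add_sum_erase _ _ hi,
      ← Finset.add_sum_erase _ _ (Finset.mem_erase.2 ⟨Ne.symm hij, hj⟩),
      ← add_assoc]
    refine natDegree_mul_le_of_le (natDegree_mul_le_of_le (hhd i) (hhd j)) ?_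
    refine (natDegree_prod_le _ _).trans (Finset.sum_le_sum fun k _ => (hdd k).le)
  have hQD := eq_leadingCoeff_mul_of_monic_of_dvd_of_natDegree_le hDmon hdvd hQdeg
  have hval : ∀ w, (∀ i ∈ S, w ^ n i ≠ c i) →
      ∑ i ∈ S, ∑ j ∈ S, K i j * (G i w * G j w) = Q.leadingCoeff := by
    intro w hw
    have h1 := hQe w hw
    have hD0 : D.eval w ≠ 0 := by
      rw [hD, eval_prod, Finset.prod_ne_zero_iff]
      exact fun i hi => hdne i w (hw i hi)
    rw [hQD, eval_mul, eval_C] at h1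
    exact (mul_right_cancel₀ hD0 h1).symm
  -- The constant is read off at 0, where each `G i` is -1/2; the signs cancel in the products.
  rw [hval w hw, ← hval 0]
  · refine Finset.sum_congr rfl fun i hi => Finset.sum_congr rfl fun j hj => ?_
    have : ∀ i ∈ S, G i 0 = -(1 / 2) := by
      intro i hi
      have := hc i hi
      rw [hG, zero_pow (hn i hi).ne']
      field_simp
      ring
    rw [this i hi, this j hj]
    ring
  · intro i hi
    rw [zero_pow (hn i hi).ne']
    exact (hc i hi).symm

end RationalIdentity

/-! ### The curvature as a commutator. -/

section Curvature

variable {ι M N : Type*} [AddCommGroup M] [Module ℝ M] [AddCommGroup N] [Module ℝ N]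
  {P : RootPairing ι ℝ M N}

lemma expWeight_ne_zero (w : weightLattice P) (p : Torus P) : expWeight w p ≠ 0 :=
  Units.ne_zero _

lemma expWeight_mul (w : weightLattice P) (p q : Torus P) :
    expWeight w (p * q) = expWeight w p * expWeight w q := by
  simp [expWeight]

lemma expWeight_add_zsmul (w w' : weightLattice P) (n : ℤ) (p : Torus P) :
    expWeight (w + n • w') p = expWeight w p * expWeight w' p ^ n := by
  simp [expWeight, ofAdd_add, ofAdd_zsmul]

/-- The element of `𝔥` attached to a real coweight. -/
def ofCoweight (P : RootPairing ι ℝ M N) (x : N) : Cartan P where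
  toFun w := (P.toLinearMap w x : ℝ)
  map_zero' := by simp
  map_add' := by simp

lemma exists_coweight [Finite ι] (P : RootPairing ι ℝ M N) (f : Dual ℝ M) :
    ∃ x : N, ∀ m, P.toLinearMap m x = f m := by
  refine ⟨P.toLinearMap.flip.toPerfPair.symm f, fun m => ?_⟩
  exact LinearMap.congr_fun (P.toLinearMap.flip.toPerfPair.apply_symm_apply f) m

variable [P.IsCrystallographic]

/-- The value of the function `e^α` attached to the `i`-th root. -/
abbrev expRoot (p : Torus P) (i : ι) : ℂ := expWeight (rootWeight P i) p

lemma rootEval_ofCoweight (i : ι) (x : N) :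
    rootEval i (ofCoweight P x) = (P.toLinearMap (P.root i) x : ℝ) := rfl

lemma expRoot_mul_torusExp (p : Torus P) (i : ι) (X : Cartan P) :
    expRoot (p * torusExp X) i = expRoot p i * Complex.exp (rootEval i X) := by
  rw [expRoot, expWeight_mul]
  rfl

lemma expRoot_add_zsmul {i j k : ι} {n : ℤ} (h : P.root k = P.root j + n • P.root i)
    (p : Torus P) : expRoot p k = expRoot p j * expRoot p i ^ n := by
  have : rootWeight P k = rootWeight P j + n • rootWeight P i := by
    ext
    simpa [rootWeight] using h
  rw [expRoot, this, expWeight_add_zsmul]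

lemma expRoot_neg {i j : ι} (h : P.root j = -P.root i) (p : Torus P) :
    expRoot p j = (expRoot p i)⁻¹ := by
  have : expRoot p j * expRoot p i = 1 := by
    have h2 : rootWeight P j = -rootWeight P i := by
      ext
      simpa [rootWeight] using h
    have h3 := expWeight_add_zsmul (rootWeight P j) (rootWeight P i) 1 p
    rw [zpow_one] at h3
    rw [expRoot, expRoot, ← h3, h2]
    simp [expWeight]
  exact eq_inv_of_mul_eq_one_left this

/-- The function `coth (x / 2) / 2` in the variable `z = e^x`. -/
def cothHalf (z : ℂ) : ℂ := (z + 1) / (2 * (z - 1))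

lemma cothHalf_inv {z : ℂ} (hz : z ≠ 0) : cothHalf z⁻¹ = -cothHalf z := by
  unfold cothHalf
  by_cases h : z = 1
  · simp [h]
  have h1 : z - 1 ≠ 0 := sub_ne_zero.2 h
  have h2 : 1 - z ≠ 0 := sub_ne_zero.2 (Ne.symm h)
  have h3 : z⁻¹ - 1 ≠ 0 := by
    rw [sub_ne_zero]
    simpa using h
  field_simp
  ring

lemma cothHalf_eq {z : ℂ} (hz : z ≠ 1) : cothHalf z = (z - 1)⁻¹ + 1 / 2 := by
  have h1 : z - 1 ≠ 0 := sub_ne_zero.2 hz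
  unfold cothHalf
  field_simp
  ring

lemma continuousAt_cothHalf {z : ℂ} (hz : z ≠ 1) : ContinuousAt cothHalf z := by
  have h1 : 2 * (z - 1) ≠ 0 := mul_ne_zero two_ne_zero (sub_ne_zero.2 hz)
  unfold cothHalf
  fun_prop (disch := assumption)

variable [Fintype ι] {A : Type*} [Ring A] [Algebra ℂ A]

open Classical in
/-- The form `∑_{α > 0} c_α dα t_α + δ`. -/
def posForm (b : P.Base) (t : ι → A) (τ : Cartan P →ₗ[ℂ] A) (c : ι → ℂ) (u : Cartan P) : A :=
  ∑ k with b.IsPos k, (c k * rootEval k u) • t k + delta b t τ u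

lemma trigForm_eq_posForm (b : P.Base) (t : ι → A) (τ : Cartan P →ₗ[ℂ] A) {p : Torus P}
    (hp : p ∈ regularSet P) (u : Cartan P) :
    trigForm b t τ p u = posForm b t τ (fun k => cothHalf (expRoot p k)) u := by
  classical
  have h : ∀ k, cothHalf (expRoot p k) = (expRoot p k - 1)⁻¹ + 1 / 2 := fun k => cothHalf_eq (hp k)
  simp only [trigForm, posForm, delta, h, LinearMap.add_apply, LinearMap.sum_apply,
    LinearMap.smul_apply, LinearMap.smulRight_apply, add_mul, add_smul, Finset.sum_add_distrib,
    mul_smul, Finset.smul_sum]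
  rw [add_add_sub_cancel]
  rfl

/-- The constant coefficient 1/2 is the limit of `cothHalf` as e^α tends to infinity. -/
lemma tau_eq_posForm (b : P.Base) (t : ι → A) (τ : Cartan P →ₗ[ℂ] A) (u : Cartan P) :
    τ u = posForm b t τ (fun _ => 1 / 2) u := by
  simp only [posForm, delta, mul_smul, Finset.smul_sum]
  rw [add_sub_cancel]

lemma posForm_eq_sum_univ (b : P.Base) {t : ι → A}
    (ht : ∀ i j, P.root j = -P.root i → t j = t i) (τ : Cartan P →ₗ[ℂ] A) {c : ι → ℂ}
    (hc : ∀ i j, P.root j = -P.root i → c j = -c i) (u : Cartan P) :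
    posForm b t τ c u = ∑ k, (1 / 2 * (c k * rootEval k u)) • t k + delta b t τ u := by
  classical
  have h := sum_eq_two_smul_sum_pos P b (fun k => (c k * rootEval k u) • t k) (by
    intro i j h
    rw [ht i j h, hc i j h, rootEval_neg h]
    ring_nf) (fun _ => True) (by simp)
  simp only [Finset.filter_true, true_and] at h
  simp only [mul_smul (1 / 2 : ℂ), ← Finset.smul_sum]
  rw [h, smul_smul, posForm]
  norm_num

lemma delta_smul_sub_smul (b : P.Base) (t : ι → A) (τ : Cartan P →ₗ[ℂ] A) (x y : ℂ)
    (u v : Cartan P) :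
    delta b t τ (x • v - y • u) = x • delta b t τ v - y • delta b t τ u := by
  have h : ∀ i, rootEval i (x • v - y • u) = x * rootEval i v - y * rootEval i u := fun i => rfl
  simp only [delta, h, map_sub, map_smul, sub_smul, Finset.sum_sub_distrib, mul_smul,
    ← Finset.smul_sum]
  module

-- The mixed terms for a root α add up to a multiple of [t_α, δ(α(u)v - α(v)u)], which is zero by
-- (tδ) because α vanishes on that vector.
open Classical in
lemma lie_posForm (b : P.Base) {t : ι → A} {τ : Cartan P →ₗ[ℂ] A} (h : RelTDelta b t τ)
    (c : ι → ℂ) (u v : Cartan P) :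
    ⁅posForm b t τ c u, posForm b t τ c v⁆ =
      ∑ i with b.IsPos i, ∑ j with b.IsPos j,
        (c i * rootEval i u * (c j * rootEval j v)) • ⁅t i, t j⁆ +
      ⁅delta b t τ u, delta b t τ v⁆ := by
  have hcross : ∀ i, rootEval i u • lieBilin A (t i) (delta b t τ v) -
      rootEval i v • lieBilin A (t i) (delta b t τ u) = 0 := by
    intro i
    have h1 := h i (rootEval i u • v - rootEval i v • u) (by
      change rootEval i u * rootEval i v - rootEval i v * rootEval i u = 0
      ring)
    rwa [delta_smul_sub_smul, lie_eq_lieBilin, map_sub, map_smul, map_smul] at h1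
  have hcross2 : ∑ i with b.IsPos i, (c i * rootEval i u) • lieBilin A (t i) (delta b t τ v) +
      ∑ i with b.IsPos i, (c i * rootEval i v) • lieBilin A (delta b t τ u) (t i) = 0 := by
    rw [← Finset.sum_add_distrib]
    refine Finset.sum_eq_zero fun i _ => ?_
    rw [lieBilin_swap (delta b t τ u), mul_smul, mul_smul, ← smul_add, smul_neg, ← sub_eq_add_neg,
      hcross i, smul_zero]
  have e1 : lieBilin A (∑ i with b.IsPos i, (c i * rootEval i u) • t i)
      (∑ i with b.IsPos i, (c i * rootEval i v) • t i) = ∑ i with b.IsPos i, ∑ j with b.IsPos j,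
        (c i * rootEval i u * (c j * rootEval j v)) • lieBilin A (t i) (t j) := by
    rw [LinearMap.map_sum₂]
    simp only [map_sum, map_smul, LinearMap.smul_apply, smul_smul]
    refine Finset.sum_congr rfl fun i _ => Finset.sum_congr rfl fun j _ => ?_
    rw [mul_comm]
  have e2 : lieBilin A (∑ i with b.IsPos i, (c i * rootEval i u) • t i) (delta b t τ v) =
      ∑ i with b.IsPos i, (c i * rootEval i u) • lieBilin A (t i) (delta b t τ v) := by
    simp only [map_sum, map_smul, LinearMap.sum_apply, LinearMap.smul_apply]
  have e3 : lieBilin A (delta b t τ u) (∑ i with b.IsPos i, (c i * rootEval i v) • t i) =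
      ∑ i with b.IsPos i, (c i * rootEval i v) • lieBilin A (delta b t τ u) (t i) := by
    simp only [map_sum, map_smul]
  rw [← e2, ← e3] at hcross2
  simp only [lie_eq_lieBilin, posForm, map_add, LinearMap.add_apply]
  rw [← e1, ← sub_eq_zero, ← hcross2]
  abel

/-- If coefficients converge, so do commutators of linear combinations. -/
lemma lie_eq_of_tendsto {α : Type*} {l : Filter α} [l.NeBot] (e : ι → A) (x y z : A)
    {a a' : α → ι → ℂ} {a₀ a₀' : ι → ℂ} {r r' : α → ℂ} {r₀ r₀' : ℂ}
    (ha : ∀ k, Filter.Tendsto (fun s => a s k) l (nhds (a₀ k)))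
    (ha' : ∀ k, Filter.Tendsto (fun s => a' s k) l (nhds (a₀' k)))
    (hr : Filter.Tendsto r l (nhds r₀)) (hr' : Filter.Tendsto r' l (nhds r₀'))
    (h : ∀ᶠ s in l, ⁅∑ k, a s k • e k + r s • x, ∑ k, a' s k • e k + r' s • y⁆ = z) :
    ⁅∑ k, a₀ k • e k + r₀ • x, ∑ k, a₀' k • e k + r₀' • y⁆ = z := by
  -- No topology on A is available: the limit is taken after applying each linear functional, where
  -- the bracket becomes a polynomial in the coefficients.
  rw [← sub_eq_zero, ← Module.forall_dual_apply_eq_zero_iff ℂ]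
  intro φ
  rw [map_sub, sub_eq_zero]
  have key : ∀ (a a' : ι → ℂ) (r r' : ℂ),
      φ ⁅∑ k, a k • e k + r • x, ∑ k, a' k • e k + r' • y⁆ =
        ∑ k, a' k * ∑ l, a l * φ (lieBilin A (e l) (e k)) +
        r * ∑ k, a' k * φ (lieBilin A x (e k)) +
        (r' * ∑ k, a k * φ (lieBilin A (e k) y) + r' * (r * φ (lieBilin A x y))) := by
    intro a a' r r'
    simp only [lie_eq_lieBilin, map_add, LinearMap.add_apply, map_sum, map_smul,
      LinearMap.sum_apply, LinearMap.smul_apply, smul_eq_mul, Finset.mul_sum,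
      Finset.sum_add_distrib, mul_add]
    congr 2
    refine Finset.sum_congr rfl fun k _ => ?_
    ring
  refine tendsto_nhds_unique (f := fun s => φ ⁅∑ k, a s k • e k + r s • x,
    ∑ k, a' s k • e k + r' s • y⁆) (l := l) ?_ ?_
  · simp only [key]
    refine Filter.Tendsto.add (Filter.Tendsto.add ?_ ?_) (Filter.Tendsto.add ?_ ?_)
    · exact tendsto_finsetSum _ fun k _ => (ha' k).mul
        (tendsto_finsetSum _ fun j _ => (ha j).mul_const _)
    · exact hr.mul (tendsto_finsetSum _ fun k _ => (ha' k).mul_const _)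
    · exact hr'.mul (tendsto_finsetSum _ fun k _ => (ha k).mul_const _)
    · exact hr'.mul (hr.mul_const _)
  · refine tendsto_const_nhds.congr' ?_
    filter_upwards [h] with s hs
    rw [hs]

omit [P.IsCrystallographic] [Fintype ι] in
lemma expWeight_curve (w : weightLattice P) (p : Torus P) (u : Cartan P) (s : ℂ) :
    expWeight w (p * torusExp (s • u)) = expWeight w p * Complex.exp (s * u w) := by
  rw [expWeight_mul]
  rfl

open Classical in
lemma hasDerivAlong_trigForm (b : P.Base) (t : ι → A) (τ : Cartan P →ₗ[ℂ] A) {p : Torus P}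
    (hp : p ∈ regularSet P) (u v : Cartan P) :
    HasDerivAlong (fun q => trigForm b t τ q v) u p (∑ k with b.IsPos k,
      (-(expRoot p k * rootEval k u) / (expRoot p k - 1) ^ 2 * rootEval k v) • t k) := by
  intro φ
  simp only [trigForm, LinearMap.add_apply, LinearMap.sum_apply, LinearMap.smul_apply,
    LinearMap.smulRight_apply, map_add, map_sum, map_smul, smul_eq_mul, expWeight_curve]
  refine HasDerivAt.add_const _ (HasDerivAt.fun_sum fun k _ => ?_)
  rw [mul_assoc]
  refine HasDerivAt.mul_const ?_ _
  have h1 : HasDerivAt (fun s : ℂ => expRoot p k * Complex.exp (s * rootEval k u) - 1)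
      (expRoot p k * rootEval k u) 0 := by
    have h2 : HasDerivAt (fun s : ℂ => s * rootEval k u) (rootEval k u) 0 := by
      simpa using (hasDerivAt_id (0 : ℂ)).mul_const (rootEval k u)
    have h3 := (h2.cexp.const_mul (expRoot p k)).sub_const 1
    simpa using h3
  have h4 := h1.fun_inv (by simpa using sub_ne_zero.2 (hp k))
  simp only [zero_mul, Complex.exp_zero, mul_one] at h4
  exact h4

/-- The derivative of ω(v) along u is symmetric in u and v, so dω = 0. -/
theorem isFlatOn_iff (b : P.Base) (t : ι → A) (τ : Cartan P →ₗ[ℂ] A) :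
    IsFlatOn (trigForm b t τ) (regularSet P) ↔
      ∀ p ∈ regularSet P, ∀ u v, ⁅trigForm b t τ p u, trigForm b t τ p v⁆ = 0 := by
  classical
  have hsymm : ∀ (p : Torus P) (u v : Cartan P), ∑ k with b.IsPos k,
      (-(expRoot p k * rootEval k u) / (expRoot p k - 1) ^ 2 * rootEval k v) • t k =
      ∑ k with b.IsPos k,
      (-(expRoot p k * rootEval k v) / (expRoot p k - 1) ^ 2 * rootEval k u) • t k := by
    intro p u v
    refine Finset.sum_congr rfl fun k _ => ?_
    congr 1
    ring
  refine forall₂_congr fun p hp => forall₂_congr fun u v => ?_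
  have h1 := hasDerivAlong_trigForm b t τ hp u v
  have h2 := hasDerivAlong_trigForm b t τ hp v u
  constructor
  · rintro ⟨x, y, hx, hy, h⟩
    have huniq : ∀ (f : Torus P → A) (u : Cartan P) (x y : A), HasDerivAlong f u p x →
        HasDerivAlong f u p y → x = y := by
      intro f u x y hx hy
      rw [← sub_eq_zero, ← Module.forall_dual_apply_eq_zero_iff ℂ]
      intro φ
      rw [map_sub, sub_eq_zero]
      exact (hx φ).unique (hy φ)
    have hxy : x = y := by
      rw [huniq _ _ _ _ hx h1, huniq _ _ _ _ hy h2, hsymm]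
    rw [hxy, sub_self, neg_zero, zero_add] at h
    exact h.symm
  · intro h
    refine ⟨_, _, h1, h2, ?_⟩
    rw [hsymm, sub_self, neg_zero, zero_add, h]

end Curvature

/-! ### The relations imply flatness. -/

section FlatOfRelations

variable {ι M N : Type*} [Fintype ι] [AddCommGroup M] [Module ℝ M] [AddCommGroup N] [Module ℝ N]
  {P : RootPairing ι ℝ M N} [P.IsCrystallographic] {A : Type*} [Ring A] [Algebra ℂ A]

omit [Fintype ι] [P.IsCrystallographic] in
lemma height_neg [P.IsReduced] (b : P.Base) {i j : ι} (h : P.root j = -P.root i) :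
    b.height j = -b.height i := by
  have h2 : j = P.reflectionPerm i i := P.root.injective (by rw [h, root_reflectionPerm_self])
  have := b.height_reflectionPerm_self i
  rw [P.indexNeg_neg] at this
  rw [h2, this]

open Classical in
/-- The curvature of the trigonometric connection at a point in general position. -/
theorem lie_trigForm_of_generic [P.IsReduced] (b : P.Base) {t : ι → A}
    (ht : ∀ i j, P.root j = -P.root i → t j = t i) {τ : Cartan P →ₗ[ℂ] A}
    (H : RelString P t) (hδ : RelTDelta b t τ) {p : Torus P} (hp : p ∈ regularSet P)
    (hgen : ∀ i j, b.IsPos i → b.IsPos j → i ≠ j →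
      expRoot p i ^ (b.height j).toNat ≠ expRoot p j ^ (b.height i).toNat) (u v : Cartan P) :
    ⁅trigForm b t τ p u, trigForm b t τ p v⁆ = ⁅τ u, τ v⁆ := by
  rw [trigForm_eq_posForm b t τ hp, trigForm_eq_posForm b t τ hp, tau_eq_posForm b t τ u,
    tau_eq_posForm b t τ v, lie_posForm b hδ, lie_posForm b hδ]
  congr 1
  rw [← sub_eq_zero, ← Module.forall_dual_apply_eq_zero_iff ℂ]
  intro φ
  rw [map_sub, sub_eq_zero]
  -- Antisymmetrising in u and v compensates the antisymmetry of the bracket: K is symmetric with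
  -- zero diagonal.
  set K : ι → ι → ℂ := fun i j =>
    1 / 2 * (rootEval i u * rootEval j v - rootEval i v * rootEval j u) * φ ⁅t i, t j⁆ with hK
  have hlie : ∀ i j, φ ⁅t i, t j⁆ = -φ ⁅t j, t i⁆ := by
    intro i j
    rw [lie_eq_lieBilin, lieBilin_swap, map_neg]
    rfl
  have hform : ∀ c : ι → ℂ, φ (∑ i with b.IsPos i, ∑ j with b.IsPos j,
        (c i * rootEval i u * (c j * rootEval j v)) • ⁅t i, t j⁆) =
      ∑ i with b.IsPos i, ∑ j with b.IsPos j, K i j * (c i * c j) := by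
    intro c
    simp only [map_sum, map_smul, smul_eq_mul]
    have h1 : ∑ i with b.IsPos i, ∑ j with b.IsPos j,
        (c i * rootEval i u * (c j * rootEval j v)) * φ ⁅t i, t j⁆ =
        ∑ i with b.IsPos i, ∑ j with b.IsPos j,
        -((c i * rootEval i v * (c j * rootEval j u)) * φ ⁅t i, t j⁆) := by
      rw [Finset.sum_comm]
      refine Finset.sum_congr rfl fun i _ => Finset.sum_congr rfl fun j _ => ?_
      rw [hlie j i]
      ring
    have h2 : ∀ x y : ℂ, x = y → x = 1 / 2 * (x + y) := by
      rintro x y rfl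
      ring
    rw [h2 _ _ h1]
    simp only [← Finset.sum_add_distrib, Finset.mul_sum]
    refine Finset.sum_congr rfl fun i _ => Finset.sum_congr rfl fun j _ => ?_
    simp only [hK]
    ring
  rw [hform, hform]
  have hE : ∀ k, expRoot p k ≠ 0 := fun k => expWeight_ne_zero _ _
  have hcoth : ∀ (E W : ℂ), E ≠ 0 → (W + E⁻¹) / (2 * (W - E⁻¹)) = cothHalf (E * W) := by
    intro E W hE0
    have e1 : E * W + 1 = E * (W + E⁻¹) := by field_simp
    have e2 : 2 * (E * W - 1) = E * (2 * (W - E⁻¹)) := by field_simp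
    rw [cothHalf, e1, e2, mul_div_mul_left _ _ hE0]
  have hpos : ∀ i, b.IsPos i → ((b.height i).toNat : ℤ) = b.height i :=
    fun i hi => Int.toNat_of_nonneg hi.le
  -- The variable w replaces e^α by e^α w^(ht α), so the pole for α is at w^(ht α) = e^(-α) and w =
  -- 1 is the point p.
  have key := sum_mul_mul_eq_of_residues (Finset.univ.filter fun k => b.IsPos k)
    (fun i => (b.height i).toNat) (by
      intro i hi
      have hi : b.IsPos i := by simpa using hi
      have : 0 < b.height i := hi
      simpa using this)
    (fun i => (expRoot p i)⁻¹) (fun i _ => inv_ne_zero (hE i)) (by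
      intro i hi j hj hij h
      simp only [inv_pow, inv_inj] at h
      exact hgen i j (by simpa using hi) (by simpa using hj) hij h)
    K (by
      intro i j
      simp only [hK]
      rw [hlie j i]
      ring) (by
      intro i
      simp only [hK]
      ring)
    (fun i w => (w ^ (b.height i).toNat + (expRoot p i)⁻¹) /
      (2 * (w ^ (b.height i).toNat - (expRoot p i)⁻¹))) (fun _ _ => rfl) (by
      intro i hi w hw
      have hi : b.IsPos i := by simpa using hi
      have hi0 : 0 < b.height i := hi
      have hw0 : w ≠ 0 := by
        rintro rfl
        rw [zero_pow (by omega)] at hw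
        exact inv_ne_zero (hE i) hw.symm
      set z : ι → ℂ := fun k => expRoot p k * w ^ b.height k with hz
      have hz0 : ∀ k, z k ≠ 0 := fun k => mul_ne_zero (hE k) (zpow_ne_zero _ hw0)
      have hzi : z i = 1 := by
        simp only [hz]
        rw [← hpos i hi, zpow_natCast, hw, mul_inv_cancel₀ (hE i)]
      have hzneg : ∀ k l, P.root l = -P.root k → z l = (z k)⁻¹ := by
        intro k l h
        simp only [hz]
        rw [expRoot_neg h, height_neg b h, zpow_neg, mul_inv]
      have hzstr : ∀ k l, stringSetoid P i k l → z k = z l := by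
        intro k l hkl
        obtain ⟨n, hn⟩ := hkl
        simp only [hz]
        rw [expRoot_add_zsmul hn, b.height_add_zsmul hn, zpow_add₀ hw0, zsmul_eq_mul, Int.cast_id,
          mul_comm n, zpow_mul]
        have : expRoot p i ^ n * (w ^ b.height i) ^ n = 1 := by
          rw [← mul_zpow]
          have := hzi
          simp only [hz] at this
          rw [this, one_zpow]
        rw [mul_assoc, mul_left_comm (expRoot p i ^ n), this]
        ring
      have h1 : ∀ j ∈ Finset.univ.filter (fun k => b.IsPos k), K i j *
          ((w ^ (b.height j).toNat + (expRoot p j)⁻¹) /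
          (2 * (w ^ (b.height j).toNat - (expRoot p j)⁻¹))) = K i j * cothHalf (z j) := by
        intro j hj
        have hj : b.IsPos j := by simpa using hj
        rw [hcoth _ _ (hE j), ← zpow_natCast, hpos j hj]
      rw [Finset.sum_congr rfl h1]
      have h2 := sum_eq_two_smul_sum_pos P b (fun j => K i j * cothHalf (z j)) (by
        intro k l h
        simp only [hK]
        rw [hzneg k l h, cothHalf_inv (hz0 k), ht k l h, rootEval_neg h, rootEval_neg h]
        ring) (fun _ => True) (by simp)
      simp only [Finset.filter_true, true_and] at h2
      -- At a pole for α, z_α = 1, so z is constant on α-strings. Adding nα to β does not change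
      -- α(u)β(v) - α(v)β(u).
      have h3 := lie_sum_eq_zero_of_string ht H i (fun j =>
        1 / 2 * (rootEval i u * rootEval j v - rootEval i v * rootEval j u) * cothHalf (z j)) (by
        intro j k _ _ hjk
        have hzz := hzstr j k hjk
        obtain ⟨n, hn⟩ := hjk
        simp only [hzz, rootEval_add_zsmul hn]
        ring)
      have h4 := congrArg φ h3
      simp only [map_sum, map_smul, smul_eq_mul, map_zero] at h4
      have h5 : ∑ j, K i j * cothHalf (z j) = 0 := by
        rw [← h4]
        refine Finset.sum_congr rfl fun j _ => ?_
        simp only [hK]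
        ring
      rw [h5] at h2
      exact (smul_eq_zero.1 h2.symm).resolve_left two_ne_zero)
    1 (by
      intro i _
      rw [one_pow, ne_eq, eq_comm, inv_eq_one]
      exact hp i)
  rw [← key]
  refine Finset.sum_congr rfl fun i _ => Finset.sum_congr rfl fun j _ => ?_
  rw [hcoth _ _ (hE i), hcoth _ _ (hE j), one_pow, one_pow, mul_one, mul_one]

lemma eventually_mul_exp_ne {a c : ℂ} (ha : a ≠ 0) {x y : ℝ} (hxy : x ≠ y) :
    ∀ᶠ s : ℝ in nhdsWithin 0 (Set.Ioi 0),
      a * Complex.exp (s * x) ≠ c * Complex.exp (s * y) := by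
  have h0 : ∀ᶠ s : ℝ in nhdsWithin 0 (Set.Ioi 0),
      a * Complex.exp (s * (x - y)) ≠ c := by
    by_cases hac : a = c
    · subst hac
      filter_upwards [self_mem_nhdsWithin] with s hs h
      have h1 : Complex.exp (s * (x - y)) = 1 := by simpa [ha] using h
      have h2 : Real.exp (s * (x - y)) = 1 := by exact_mod_cast h1
      rw [Real.exp_eq_one_iff] at h2
      rcases mul_eq_zero.1 h2 with h3 | h3
      · exact (ne_of_gt hs) h3
      · exact hxy (sub_eq_zero.1 h3)
    · have hc : ContinuousAt (fun s : ℝ => a * Complex.exp (s * (x - y))) 0 := by fun_prop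
      refine (hc.eventually_ne ?_).filter_mono nhdsWithin_le_nhds
      simpa using hac
  filter_upwards [h0] with s hs h
  apply hs
  rw [mul_sub, Complex.exp_sub, ← mul_div_assoc, h, mul_div_assoc, div_self (Complex.exp_ne_zero _),
    mul_one]

/-- Every point of the torus is a limit of regular points in general position. -/
lemma exists_generic_direction [P.IsReduced] (b : P.Base) :
    ∃ X : Cartan P, ∀ p : Torus P, ∀ᶠ s : ℝ in nhdsWithin 0 (Set.Ioi 0),
      p * torusExp ((s : ℂ) • X) ∈ regularSet P ∧
      ∀ i j, b.IsPos i → b.IsPos j → i ≠ j →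
        expRoot (p * torusExp ((s : ℂ) • X)) i ^ (b.height j).toNat ≠
          expRoot (p * torusExp ((s : ℂ) • X)) j ^ (b.height i).toNat := by
  classical
  -- The direction must avoid the kernels of the roots and of the vectors ht(β)α - ht(α)β, which
  -- govern coincidences of poles. These are nonzero because distinct positive roots are
  -- independent.
  obtain ⟨f, hf⟩ := Module.exists_dual_forall_apply_ne_zero (K := ℝ)
    (Sum.elim P.root fun q : {q : ι × ι // b.IsPos q.1 ∧ b.IsPos q.2 ∧ q.1 ≠ q.2} =>
      ((b.height q.1.2).toNat : ℝ) • P.root q.1.1 -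
        ((b.height q.1.1).toNat : ℝ) • P.root q.1.2) (by
    rintro (i | ⟨⟨i, j⟩, hi, hj, hij⟩)
    · exact P.ne_zero i
    · intro h
      have hli := linearIndependent_roots P (i := i) (j := j) (Ne.symm hij) (by
        intro h
        exact (isPos_neg_iff b h).1 hj hi)
      rw [LinearIndependent.pair_iff] at hli
      have := (hli (b.height j).toNat (-((b.height i).toNat : ℝ)) (by
        rw [neg_smul, ← sub_eq_add_neg]; exact h)).1
      have hj0 : 0 < b.height j := hj
      have h1 : (b.height j).toNat = 0 := by exact_mod_cast this
      omega)
  obtain ⟨x, hx⟩ := exists_coweight P f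
  refine ⟨ofCoweight P x, fun p => ?_⟩
  have hE : ∀ k (s : ℝ), expRoot (p * torusExp ((s : ℂ) • ofCoweight P x)) k =
      expRoot p k * Complex.exp (s * (f (P.root k) : ℝ)) := by
    intro k s
    rw [expRoot_mul_torusExp, rootEval_smul, rootEval_ofCoweight, hx]
  have hE0 : ∀ k, expRoot p k ≠ 0 := fun k => expWeight_ne_zero _ _
  refine Filter.Eventually.and ?_ ?_
  · refine Filter.eventually_all.2 fun i => ?_
    have h1 := eventually_mul_exp_ne (c := 1) (hE0 i) (hf (Sum.inl i))
    filter_upwards [h1] with s hs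
    change expRoot _ i ≠ 1
    rw [hE]
    simpa using hs
  · refine Filter.eventually_all.2 fun i => Filter.eventually_all.2 fun j =>
      Filter.eventually_all.2 fun hi => Filter.eventually_all.2 fun hj =>
      Filter.eventually_all.2 fun hij => ?_
    have h1 := hf (Sum.inr ⟨⟨i, j⟩, hi, hj, hij⟩)
    simp only [Sum.elim_inr, map_sub, map_smul, smul_eq_mul] at h1
    have h2 := eventually_mul_exp_ne (c := expRoot p j ^ (b.height i).toNat)
      (pow_ne_zero (b.height j).toNat (hE0 i)) (sub_ne_zero.1 h1)
    filter_upwards [h2] with s hs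
    rw [hE, hE, mul_pow, mul_pow, ← Complex.exp_nat_mul, ← Complex.exp_nat_mul]
    convert! hs using 3
    · push_cast; ring_nf
    · push_cast; ring_nf

lemma posForm_trig_eq_sum_univ (b : P.Base) {t : ι → A}
    (ht : ∀ i j, P.root j = -P.root i → t j = t i) (τ : Cartan P →ₗ[ℂ] A) {p : Torus P}
    (hp : p ∈ regularSet P) (u : Cartan P) :
    trigForm b t τ p u =
      ∑ k, (1 / 2 * (cothHalf (expRoot p k) * rootEval k u)) • t k + (1 : ℂ) • delta b t τ u := by
  rw [trigForm_eq_posForm b t τ hp, posForm_eq_sum_univ b ht, one_smul]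
  intro i j h
  exact (congrArg cothHalf (expRoot_neg h p)).trans
    (cothHalf_inv (expWeight_ne_zero (rootWeight P i) p))

/-- Under the relations `(tt)` and `(tδ)` the curvature is constant. -/
theorem lie_trigForm [P.IsReduced] (b : P.Base) {t : ι → A}
    (ht : ∀ i j, P.root j = -P.root i → t j = t i) {τ : Cartan P →ₗ[ℂ] A}
    (H : RelString P t) (hδ : RelTDelta b t τ) {p : Torus P} (hp : p ∈ regularSet P)
    (u v : Cartan P) :
    ⁅trigForm b t τ p u, trigForm b t τ p v⁆ = ⁅τ u, τ v⁆ := by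
  obtain ⟨X, hX⟩ := exists_generic_direction b
  have hlim : ∀ (u : Cartan P) (k : ι), Filter.Tendsto (fun s : ℝ => 1 / 2 *
      (cothHalf (expRoot (p * torusExp ((s : ℂ) • X)) k) * rootEval k u))
      (nhdsWithin 0 (Set.Ioi 0)) (nhds (1 / 2 * (cothHalf (expRoot p k) * rootEval k u))) := by
    intro u k
    refine (Filter.Tendsto.mul_const _ ?_).const_mul _
    have h1 : ContinuousAt (fun s : ℝ => cothHalf (expRoot (p * torusExp ((s : ℂ) • X)) k)) 0 := by
      simp only [expRoot_mul_torusExp, rootEval_smul]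
      refine ContinuousAt.comp (g := cothHalf) ?_ (by fun_prop)
      apply continuousAt_cothHalf
      simpa using hp k
    have h2 := h1.tendsto.mono_left (nhdsWithin_le_nhds (s := Set.Ioi 0))
    simp only [expRoot_mul_torusExp, rootEval_smul, Complex.ofReal_zero, zero_mul,
      Complex.exp_zero, mul_one] at h2 ⊢
    exact h2
  rw [posForm_trig_eq_sum_univ b ht τ hp, posForm_trig_eq_sum_univ b ht τ hp]
  refine lie_eq_of_tendsto (l := nhdsWithin (0 : ℝ) (Set.Ioi 0)) t _ _ _ (hlim u) (hlim v)
    tendsto_const_nhds tendsto_const_nhds ?_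
  filter_upwards [hX p] with s hs
  rw [← posForm_trig_eq_sum_univ b ht τ hs.1, ← posForm_trig_eq_sum_univ b ht τ hs.1]
  exact lie_trigForm_of_generic b ht H hδ hs.1 hs.2 u v

lemma regularSet_nonempty [P.IsReduced] (b : P.Base) : (regularSet P).Nonempty := by
  obtain ⟨X, hX⟩ := exists_generic_direction b
  obtain ⟨s, hs⟩ := (hX 1).exists
  exact ⟨_, hs.1⟩

end FlatOfRelations

/-! ### Flatness implies the relations. -/

section RelationsOfFlat

variable {ι M N : Type*} [Fintype ι] [AddCommGroup M] [Module ℝ M] [AddCommGroup N] [Module ℝ N]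
  {P : RootPairing ι ℝ M N}

/-- Roots of a reduced root system are primitive vectors of the root lattice. -/
lemma exists_int_of_smul_root_mem [P.IsRootSystem] [P.IsCrystallographic] [P.IsReduced]
    (b : P.Base) (i : ι) (c : ℝ)
    (h : c • P.root i ∈ AddSubgroup.closure (Set.range P.root)) : ∃ n : ℤ, c = n := by
  classical
  -- The root lattice is stable under reflections, so α may be taken simple; it is then part of a
  -- ℤ-basis of the lattice.
  refine b.induction_reflect i
    (p := fun i => c • P.root i ∈ AddSubgroup.closure (Set.range P.root) → ∃ n : ℤ, c = n)
    ?_ ?_ ?_ h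
  · intro i hi h
    apply hi
    rw [root_reflectionPerm_self, smul_neg] at h
    simpa using h
  · intro i hi h
    have h1 : AddSubgroup.closure (Set.range P.root) ≤
        ((Int.castAddHom ℝ).range.comap (b.toWeightBasis.coord ⟨i, hi⟩).toAddMonoidHom) := by
      rw [← Submodule.span_int_eq_addSubgroupClosure, ← b.span_int_root_support,
        Submodule.span_int_eq_addSubgroupClosure, AddSubgroup.closure_le]
      rintro - ⟨j, hj, rfl⟩
      have h2 : P.root j = b.toWeightBasis ⟨j, hj⟩ := by simp
      simp only [SetLike.mem_coe, AddSubgroup.mem_comap, LinearMap.toAddMonoidHom_coe, h2,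
        Basis.coord_apply, Basis.repr_self]
      rw [Finsupp.single_apply]
      split_ifs
      · exact ⟨1, by simp⟩
      · exact ⟨0, by simp⟩
    obtain ⟨n, hn⟩ := h1 h
    have h2 : P.root i = b.toWeightBasis ⟨i, hi⟩ := by simp
    refine ⟨n, ?_⟩
    simp only [LinearMap.toAddMonoidHom_coe, map_smul, h2, Basis.coord_apply, Basis.repr_self,
      Finsupp.single_eq_same, smul_eq_mul, mul_one] at hn
    exact hn.symm
  · intro i j hi _ h
    apply hi
    have h1 : AddSubgroup.closure (Set.range P.root) ≤ (AddSubgroup.closure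
        (Set.range P.root)).comap (P.reflection j).toLinearMap.toAddMonoidHom := by
      rw [AddSubgroup.closure_le]
      rintro - ⟨k, rfl⟩
      refine AddSubgroup.subset_closure ⟨P.reflectionPerm j k, ?_⟩
      rw [P.root_reflectionPerm]
      rfl
    have h2 : P.reflection j (c • P.root (P.reflectionPerm j i)) ∈
      AddSubgroup.closure (Set.range P.root) := h1 h
    rw [map_smul, ← P.root_reflectionPerm, P.reflectionPerm_self] at h2
    exact h2

omit [Fintype ι] in
lemma exists_dual_apply_pair {i j : ι} (h : LinearIndependent ℝ ![P.root i, P.root j]) (a c : ℝ) :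
    ∃ f : Dual ℝ M, f (P.root i) = a ∧ f (P.root j) = c := by
  obtain ⟨f, hf⟩ := LinearMap.exists_extend ((Basis.span h).constr ℝ ![a, c])
  have h1 : ∀ k, f (![P.root i, P.root j] k) = ![a, c] k := by
    intro k
    have h2 := LinearMap.congr_fun hf (Basis.span h k)
    rw [Basis.constr_basis, LinearMap.comp_apply, Submodule.subtype_apply, Basis.span_apply] at h2
    exact h2
  exact ⟨f, h1 0, h1 1⟩

/-- A functional on the quotient by W can avoid the finitely many nonzero images of roots. -/
lemma exists_dual_root_eq_zero_iff (P : RootPairing ι ℝ M N) (W : Submodule ℝ M) :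
    ∃ f : Dual ℝ M, ∀ k, f (P.root k) = 0 ↔ P.root k ∈ W := by
  obtain ⟨f, hf⟩ := Module.exists_dual_forall_apply_ne_zero (K := ℝ)
    (fun k : {k // P.root k ∉ W} => W.mkQ (P.root k)) (by
      rintro ⟨k, hk⟩
      simpa using hk)
  refine ⟨f.comp W.mkQ, fun k => ⟨fun h => ?_, fun h => ?_⟩⟩
  · by_contra hk
    exact hf ⟨k, hk⟩ h
  · have : W.mkQ (P.root k) = 0 := by simpa using h
    rw [LinearMap.comp_apply, this, map_zero]

lemma tendsto_slope_exp (a c : ℂ) :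
    Filter.Tendsto (fun s : ℝ => (Complex.exp (s * a + s ^ 2 * c) - 1) / s)
      (nhdsWithin 0 (Set.Ioi 0)) (nhds a) := by
  have h1 : HasDerivAt (fun s : ℂ => s * a + s ^ 2 * c) a 0 := by
    simpa using ((hasDerivAt_id (0 : ℂ)).mul_const a).fun_add
      (((hasDerivAt_id (0 : ℂ)).pow 2).mul_const c)
  have h2 : HasDerivAt (fun s : ℂ => Complex.exp (s * a + s ^ 2 * c)) a 0 := by
    simpa using h1.cexp
  have h3 := h2.tendsto_slope_zero
  have h4 : Filter.Tendsto (fun s : ℝ => (s : ℂ)) (nhdsWithin 0 (Set.Ioi 0))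
      (nhdsWithin 0 {0}ᶜ) := by
    refine tendsto_nhdsWithin_iff.2 ⟨?_, ?_⟩
    · have : ContinuousAt (fun s : ℝ => (s : ℂ)) 0 := by fun_prop
      simpa using this.tendsto.mono_left (nhdsWithin_le_nhds (s := Set.Ioi 0))
    · filter_upwards [self_mem_nhdsWithin] with s hs
      simpa using (ne_of_gt hs)
  refine (h3.comp h4).congr fun s => ?_
  simp [div_eq_inv_mul]

lemma eventually_exp_ne_one {a : ℂ} (ha : a ≠ 0) (c : ℂ) :
    ∀ᶠ s : ℝ in nhdsWithin 0 (Set.Ioi 0), Complex.exp (s * a + s ^ 2 * c) ≠ 1 := by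
  filter_upwards [(tendsto_slope_exp a c).eventually_ne ha] with s hs h
  apply hs
  rw [h, sub_self, zero_div]

/-- This is the simple pole of (1/2) coth(x/2) at 0, with residue 1; the quadratic term does not
affect the limit. -/
lemma tendsto_mul_cothHalf_exp {a : ℂ} (ha : a ≠ 0) (c : ℂ) :
    Filter.Tendsto (fun s : ℝ => s * cothHalf (Complex.exp (s * a + s ^ 2 * c)))
      (nhdsWithin 0 (Set.Ioi 0)) (nhds a⁻¹) := by
  have h1 := tendsto_slope_exp a c
  have h2 : Filter.Tendsto (fun s : ℝ => (Complex.exp (s * a + s ^ 2 * c) + 1) / 2)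
      (nhdsWithin 0 (Set.Ioi 0)) (nhds 1) := by
    have : ContinuousAt (fun s : ℝ => (Complex.exp (s * a + s ^ 2 * c) + 1) / 2) 0 := by fun_prop
    have h3 := this.tendsto.mono_left (nhdsWithin_le_nhds (s := Set.Ioi 0))
    have h4 : (Complex.exp (((0 : ℝ) : ℂ) * a + ((0 : ℝ) : ℂ) ^ 2 * c) + 1) / 2 = 1 := by
      norm_num
    rwa [h4] at h3
  have h5 := h2.div h1 ha
  rw [one_div] at h5
  refine h5.congr fun s => ?_
  change (Complex.exp (s * a + s ^ 2 * c) + 1) / 2 / ((Complex.exp (s * a + s ^ 2 * c) - 1) / s) = _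
  simp only [cothHalf, div_eq_mul_inv, mul_inv, inv_inv]
  ring

lemma tendsto_ofReal_zero : Filter.Tendsto (fun s : ℝ => (s : ℂ)) (nhdsWithin 0 (Set.Ioi 0))
    (nhds 0) := by
  have : ContinuousAt (fun s : ℝ => (s : ℂ)) 0 := by fun_prop
  simpa using this.tendsto.mono_left (nhdsWithin_le_nhds (s := Set.Ioi 0))

lemma tendsto_sq_zero : Filter.Tendsto (fun s : ℝ => s ^ 2) (nhdsWithin 0 (Set.Ioi 0))
    (nhdsWithin 0 (Set.Ioi 0)) := by
  refine tendsto_nhdsWithin_iff.2 ⟨?_, ?_⟩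
  · have : ContinuousAt (fun s : ℝ => s ^ 2) 0 := by fun_prop
    simpa using this.tendsto.mono_left (nhdsWithin_le_nhds (s := Set.Ioi 0))
  · filter_upwards [self_mem_nhdsWithin] with s hs
    exact pow_pos (Set.mem_Ioi.1 hs) 2

variable {A : Type*} [Ring A] [Algebra ℂ A]

open Classical in
lemma sum_parallel_smul {t : ι → A} (ht : ∀ i j, P.root j = -P.root i → t j = t i) (i : ι) :
    ∑ k, (if k = i ∨ P.root k = -P.root i then 1 / 2 else 0 : ℂ) • t k = t i := by
  have hr := root_reflectionPerm_self P i
  have hne : i ≠ P.reflectionPerm i i := by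
    intro h
    rw [← h, eq_neg_iff_add_eq_zero, ← two_smul ℝ] at hr
    exact P.ne_zero i ((smul_eq_zero.1 hr).resolve_left two_ne_zero)
  rw [← Finset.sum_subset (Finset.subset_univ {i, P.reflectionPerm i i}), Finset.sum_pair hne,
    if_pos (Or.inl rfl), if_pos (Or.inr hr), ht _ _ hr, ← add_smul]
  · norm_num
  · intro k _ hk
    rw [if_neg, zero_smul]
    rintro (h | h)
    · exact hk (by simp [h])
    · have : k = P.reflectionPerm i i := P.root.injective (by rw [h, hr])
      exact hk (by simp [this])

variable [P.IsCrystallographic]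

/-- The limit point exp(X + 2πiY) is chosen so that e^γ = 1 there exactly for γ ∈ ℤα + ℤβ. It is
approached at speed s along Y, where α(Y) = 0, and at speed s² along Z, where α(Z) = 1. Then s²ω(Z)
tends to t_α, while sω(Y) tends to half the sum of t_γ over the roots γ ≠ ±α of the lattice. -/
theorem relPlane_of_flat [P.IsRootSystem] [P.IsReduced] (b : P.Base) {t : ι → A}
    (ht : ∀ i j, P.root j = -P.root i → t j = t i) {τ : Cartan P →ₗ[ℂ] A}
    (H : ∀ p ∈ regularSet P, ∀ u v, ⁅trigForm b t τ p u, trigForm b t τ p v⁆ = 0) :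
    RelPlane P t := by
  classical
  intro i j hij
  set W := Submodule.span ℝ {P.root i, P.root j} with hW
  obtain ⟨f, hf⟩ := exists_dual_root_eq_zero_iff P W
  obtain ⟨g, hgi, hgj⟩ := exists_dual_apply_pair hij 0 1
  obtain ⟨h, hhi, -⟩ := exists_dual_apply_pair hij 1 0
  obtain ⟨x, hx⟩ := exists_coweight P f
  obtain ⟨y, hy⟩ := exists_coweight P g
  obtain ⟨z, hz⟩ := exists_coweight P h
  set X := ofCoweight P x
  set Y := ofCoweight P y
  set Z := ofCoweight P z
  have hX : ∀ k, rootEval k X = (f (P.root k) : ℝ) := fun k => by rw [rootEval_ofCoweight, hx]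
  have hY : ∀ k, rootEval k Y = (g (P.root k) : ℝ) := fun k => by rw [rootEval_ofCoweight, hy]
  have hZ : ∀ k, rootEval k Z = (h (P.root k) : ℝ) := fun k => by rw [rootEval_ofCoweight, hz]
  set p : ℝ → Torus P := fun s =>
    torusExp (X + (2 * Real.pi * Complex.I + s : ℂ) • Y + (s ^ 2 : ℂ) • Z) with hp
  have hE : ∀ k s, expRoot (p s) k = Complex.exp ((f (P.root k) : ℝ) +
      (2 * Real.pi * Complex.I + s) * (g (P.root k) : ℝ) + s ^ 2 * (h (P.root k) : ℝ)) := by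
    intro k s
    rw [← hX, ← hY, ← hZ]
    rfl
  have hin : ∀ k, k ∈ planeSet P i j → ∀ s, expRoot (p s) k =
      Complex.exp (s * (g (P.root k) : ℝ) + s ^ 2 * (h (P.root k) : ℝ)) := by
    rintro k ⟨m, n, hk⟩ s
    have hfk : f (P.root k) = 0 := by
      rw [hf, hk]
      exact add_mem (zsmul_mem (Submodule.subset_span (by simp)) _)
        (zsmul_mem (Submodule.subset_span (by simp)) _)
    have hgk : g (P.root k) = n := by
      rw [hk, map_add, map_zsmul, map_zsmul, hgi, hgj]
      simp
    rw [hE, hfk, hgk]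
    have : (((0 : ℝ) : ℂ) + (2 * Real.pi * Complex.I + s) * ((n : ℝ) : ℂ) +
        s ^ 2 * (h (P.root k) : ℝ)) = (s * ((n : ℝ) : ℂ) + s ^ 2 * (h (P.root k) : ℝ)) +
        n * (2 * Real.pi * Complex.I) := by
      push_cast
      ring
    rw [this, Complex.exp_add, Complex.exp_int_mul_two_pi_mul_I, mul_one]
  -- The real part of the exponent forces the root into the real plane of α and β; the imaginary
  -- part forces its β-coefficient to be an integer.
  have hout : ∀ k, k ∉ planeSet P i j → expRoot (p 0) k ≠ 1 := by
    intro k hk h1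
    rw [hE, Complex.exp_eq_one_iff] at h1
    obtain ⟨n, hn⟩ := h1
    have hre := congrArg Complex.re hn
    have him := congrArg Complex.im hn
    simp at hre him
    have hmem := (hf k).1 hre
    obtain ⟨c, d, hcd⟩ := Submodule.mem_span_pair.1 hmem
    have hd : g (P.root k) = d := by
      rw [← hcd, map_add, map_smul, map_smul, hgi, hgj]
      simp
    have hdn : d = n := by
      rw [hd, mul_comm] at him
      exact mul_right_cancel₀ (by positivity) him
    -- The α-coefficient is so far only real; it is an integer because α is primitive in the root
    -- lattice.
    have h3 : c • P.root i ∈ AddSubgroup.closure (Set.range P.root) := by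
      have h4 : c • P.root i = P.root k - n • P.root j := by
        rw [← hcd, hdn, Int.cast_smul_eq_zsmul, add_sub_cancel_right]
      rw [h4]
      exact sub_mem (AddSubgroup.subset_closure (Set.mem_range_self _))
        (zsmul_mem (AddSubgroup.subset_closure (Set.mem_range_self _)) _)
    obtain ⟨m, hm⟩ := exists_int_of_smul_root_mem b i c h3
    exact hk ⟨m, n, by rw [← hcd, hm, hdn, Int.cast_smul_eq_zsmul, Int.cast_smul_eq_zsmul]⟩
  have hpar : ∀ k, k ∈ planeSet P i j → g (P.root k) = 0 → k = i ∨ P.root k = -P.root i := by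
    rintro k ⟨m, n, hk⟩ hg
    by_contra! hne
    have hli := linearIndependent_roots P hne.1 hne.2
    have hgk : g (P.root k) = n := by
      rw [hk, map_add, map_zsmul, map_zsmul, hgi, hgj]
      simp
    have hn : n = 0 := by
      rw [hgk] at hg
      exact_mod_cast hg
    rw [LinearIndependent.pair_iff] at hli
    simpa using hli m (-1) (by rw [hk, hn, Int.cast_smul_eq_zsmul]; module)
  have hpar' : ∀ k, k = i ∨ P.root k = -P.root i → k ∈ planeSet P i j ∧ g (P.root k) = 0 ∧
      (h (P.root k) = 1 ∨ h (P.root k) = -1) := by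
    rintro k (rfl | hk)
    · exact ⟨⟨1, 0, by module⟩, hgi, Or.inl hhi⟩
    · exact ⟨⟨-1, 0, by rw [hk]; module⟩, by rw [hk, map_neg, hgi, neg_zero],
        Or.inr (by rw [hk, map_neg, hhi])⟩
  have hcont : ∀ k, ContinuousAt (fun s => expRoot (p s) k) 0 := by
    intro k
    simp only [hE]
    fun_prop
  have hlimout : ∀ k, k ∉ planeSet P i j → Filter.Tendsto (fun s => cothHalf (expRoot (p s) k))
      (nhdsWithin 0 (Set.Ioi 0)) (nhds (cothHalf (expRoot (p 0) k))) := by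
    intro k hk
    have h1 : ContinuousAt (fun s => cothHalf (expRoot (p s) k)) 0 :=
      ContinuousAt.comp (g := cothHalf) (continuousAt_cothHalf (hout k hk)) (hcont k)
    exact h1.tendsto.mono_left nhdsWithin_le_nhds
  have hreg : ∀ᶠ s in nhdsWithin 0 (Set.Ioi 0), p s ∈ regularSet P := by
    refine Filter.eventually_all.2 fun k => ?_
    change ∀ᶠ s in nhdsWithin 0 (Set.Ioi 0), expRoot (p s) k ≠ 1
    by_cases hk : k ∈ planeSet P i j
    · simp only [hin k hk]
      by_cases hg : g (P.root k) = 0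
      · have h1 := tendsto_sq_zero.eventually (eventually_exp_ne_one (a := (h (P.root k) : ℝ)) (by
          rcases (hpar' k (hpar k hk hg)).2.2 with h2 | h2 <;> simp [h2]) 0)
        filter_upwards [h1] with s hs
        simpa [hg] using hs
      · exact eventually_exp_ne_one (by exact_mod_cast hg) _
    · exact ((hcont k).eventually_ne (hout k hk)).filter_mono nhdsWithin_le_nhds
  have hlimZ : ∀ k, Filter.Tendsto
      (fun s : ℝ => (s : ℂ) ^ 2 * (1 / 2 * (cothHalf (expRoot (p s) k) * rootEval k Z)))
      (nhdsWithin 0 (Set.Ioi 0))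
      (nhds (if k = i ∨ P.root k = -P.root i then 1 / 2 else 0)) := by
    intro k
    by_cases hk : k = i ∨ P.root k = -P.root i
    · obtain ⟨hk1, hk2, hk3⟩ := hpar' k hk
      have hne : ((h (P.root k) : ℝ) : ℂ) ≠ 0 := by
        rcases hk3 with h2 | h2 <;> simp [h2]
      have h1 := ((tendsto_mul_cothHalf_exp hne 0).comp tendsto_sq_zero).mul_const
        (1 / 2 * rootEval k Z)
      rw [hZ] at h1 ⊢
      rw [if_pos hk]
      have h2 : ((h (P.root k) : ℝ) : ℂ)⁻¹ * (1 / 2 * ((h (P.root k) : ℝ) : ℂ)) = 1 / 2 := by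
        field_simp
      rw [h2] at h1
      refine h1.congr fun s => ?_
      simp only [Function.comp, hin k hk1, hk2]
      push_cast
      simp only [mul_zero, add_zero, zero_add]
      ring
    · rw [if_neg hk]
      by_cases hk1 : k ∈ planeSet P i j
      · have hg : g (P.root k) ≠ 0 := fun hg => hk (hpar k hk1 hg)
        have h1 := (tendsto_ofReal_zero.mul (tendsto_mul_cothHalf_exp (a := (g (P.root k) : ℝ))
          (by exact_mod_cast hg) (h (P.root k) : ℝ))).mul_const (1 / 2 * rootEval k Z)
        simp only [zero_mul] at h1
        refine h1.congr fun s => ?_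
        rw [hin k hk1]
        ring
      · have h1 := ((tendsto_ofReal_zero.pow 2).mul (hlimout k hk1)).mul_const
          (1 / 2 * rootEval k Z)
        simp only [ne_eq, OfNat.ofNat_ne_zero, not_false_eq_true, zero_pow, zero_mul] at h1
        refine h1.congr fun s => ?_
        ring
  have hlimY : ∀ k, Filter.Tendsto
      (fun s : ℝ => (s : ℂ) * (1 / 2 * (cothHalf (expRoot (p s) k) * rootEval k Y)))
      (nhdsWithin 0 (Set.Ioi 0))
      (nhds (if k ∈ planeSet P i j ∧ g (P.root k) ≠ 0 then 1 / 2 else 0)) := by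
    intro k
    by_cases hk1 : k ∈ planeSet P i j
    · by_cases hg : g (P.root k) = 0
      · simp [hY, hg]
      · have hne : ((g (P.root k) : ℝ) : ℂ) ≠ 0 := by exact_mod_cast hg
        have h1 := (tendsto_mul_cothHalf_exp hne (h (P.root k) : ℝ)).mul_const
          (1 / 2 * rootEval k Y)
        rw [hY] at h1 ⊢
        rw [if_pos ⟨hk1, hg⟩]
        have h2 : ((g (P.root k) : ℝ) : ℂ)⁻¹ * (1 / 2 * ((g (P.root k) : ℝ) : ℂ)) = 1 / 2 := by
          field_simp
        rw [h2] at h1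
        refine h1.congr fun s => ?_
        rw [hin k hk1]
        ring
    · rw [if_neg (fun h => hk1 h.1)]
      have h1 := (tendsto_ofReal_zero.mul (hlimout k hk1)).mul_const (1 / 2 * rootEval k Y)
      simp only [zero_mul] at h1
      refine h1.congr fun s => ?_
      ring
  -- The terms δ(Z) and δ(Y) carry the factors s² and s, and disappear in the limit.
  have hfin := lie_eq_of_tendsto (l := nhdsWithin (0 : ℝ) (Set.Ioi 0)) t (delta b t τ Z)
    (delta b t τ Y) 0 hlimZ hlimY (r := fun s : ℝ => (s : ℂ) ^ 2 * 1)
    (r' := fun s : ℝ => (s : ℂ) * 1)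
    (r₀ := 0) (r₀' := 0)
    (by simpa using tendsto_ofReal_zero.pow 2) (by simpa using tendsto_ofReal_zero) (by
      filter_upwards [hreg] with s hs
      have h1 := H (p s) hs Z Y
      rw [posForm_trig_eq_sum_univ b ht τ hs, posForm_trig_eq_sum_univ b ht τ hs] at h1
      simp only [mul_smul (_ ^ 2 : ℂ), mul_smul (Complex.ofReal s), ← Finset.smul_sum, ← smul_add]
      rw [lie_eq_lieBilin, map_smul, LinearMap.map_smul₂, ← lie_eq_lieBilin, h1, smul_zero,
        smul_zero])
  rw [sum_parallel_smul ht, zero_smul, zero_smul, add_zero, add_zero, lie_eq_lieBilin,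
    map_sum] at hfin
  have h5 : (1 / 2 : ℂ) • ∑ k with k ∈ planeSet P i j, ⁅t i, t k⁆ = 0 := by
    rw [← hfin, Finset.smul_sum, Finset.sum_filter]
    refine Finset.sum_congr rfl fun k _ => ?_
    by_cases hk1 : k ∈ planeSet P i j
    · by_cases hg : g (P.root k) = 0
      · rw [if_pos hk1, if_neg (fun h => h.2 hg), lie_eq_zero_of_parallel ht, smul_zero, zero_smul,
          map_zero]
        have := hpar k hk1 hg
        tauto
      · rw [if_pos hk1, if_pos ⟨hk1, hg⟩, map_smul]
        rfl
    · rw [if_neg hk1, if_neg (fun h => hk1 h.1), zero_smul, map_zero]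
  exact (smul_eq_zero.1 h5).resolve_left (by norm_num)

/-- At a point of the torus where e^γ = 1 only for γ = ±α, sω(Z) tends to t_α. If α(v) = 0, then
ω(v) has no pole and tends to δ(v) plus a combination of the t_γ. -/
theorem relTDelta_of_flat [P.IsReduced] (b : P.Base) {t : ι → A}
    (ht : ∀ i j, P.root j = -P.root i → t j = t i) {τ : Cartan P →ₗ[ℂ] A}
    (H : ∀ p ∈ regularSet P, ∀ u v, ⁅trigForm b t τ p u, trigForm b t τ p v⁆ = 0)
    (hS : RelString P t) : RelTDelta b t τ := by
  classical
  intro i v hv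
  obtain ⟨f, hf⟩ := exists_dual_root_eq_zero_iff P (Submodule.span ℝ {P.root i})
  obtain ⟨h, hhi⟩ : ∃ h : Dual ℝ M, h (P.root i) = 1 :=
    ⟨(2 : ℝ)⁻¹ • P.coroot' i, by simp⟩
  obtain ⟨x, hx⟩ := exists_coweight P f
  obtain ⟨z, hz⟩ := exists_coweight P h
  set X := ofCoweight P x
  set Z := ofCoweight P z
  have hX : ∀ k, rootEval k X = (f (P.root k) : ℝ) := fun k => by rw [rootEval_ofCoweight, hx]
  have hZ : ∀ k, rootEval k Z = (h (P.root k) : ℝ) := fun k => by rw [rootEval_ofCoweight, hz]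
  set p : ℝ → Torus P := fun s => torusExp (X + (s : ℂ) • Z) with hp
  have hE : ∀ k s, expRoot (p s) k = Complex.exp ((f (P.root k) : ℝ) +
      s * (h (P.root k) : ℝ)) := by
    intro k s
    rw [← hX, ← hZ]
    rfl
  have hfi : f (P.root i) = 0 := (hf i).2 (Submodule.mem_span_singleton_self _)
  have hpar : ∀ k, f (P.root k) = 0 → k = i ∨ P.root k = -P.root i := by
    intro k hk
    by_contra! hne
    have hli := linearIndependent_roots P hne.1 hne.2
    obtain ⟨c, hc⟩ := Submodule.mem_span_singleton.1 ((hf k).1 hk)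
    rw [LinearIndependent.pair_iff] at hli
    simpa using hli c (-1) (by rw [hc]; module)
  have hpar' : ∀ k, k = i ∨ P.root k = -P.root i → f (P.root k) = 0 ∧
      ((h (P.root k) : ℝ) : ℂ) ≠ 0 ∧ rootEval k v = 0 := by
    rintro k (rfl | hk)
    · exact ⟨hfi, by simp [hhi], hv⟩
    · exact ⟨by rw [hk, map_neg, hfi, neg_zero], by simp [hk, hhi],
        by rw [rootEval_neg hk, hv, neg_zero]⟩
  have hcont : ∀ k, ContinuousAt (fun s => expRoot (p s) k) 0 := by
    intro k
    simp only [hE]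
    fun_prop
  have hE0 : ∀ k, expRoot (p 0) k = Complex.exp (f (P.root k) : ℝ) := by
    intro k
    simp [hE]
  have hout : ∀ k, f (P.root k) ≠ 0 → expRoot (p 0) k ≠ 1 := by
    intro k hk h1
    rw [hE0] at h1
    have h2 : Real.exp (f (P.root k)) = 1 := by exact_mod_cast h1
    exact hk ((Real.exp_eq_one_iff _).1 h2)
  have hlimout : ∀ k, f (P.root k) ≠ 0 → Filter.Tendsto (fun s => cothHalf (expRoot (p s) k))
      (nhdsWithin 0 (Set.Ioi 0)) (nhds (cothHalf (expRoot (p 0) k))) := by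
    intro k hk
    have h1 : ContinuousAt (fun s => cothHalf (expRoot (p s) k)) 0 :=
      ContinuousAt.comp (g := cothHalf) (continuousAt_cothHalf (hout k hk)) (hcont k)
    exact h1.tendsto.mono_left nhdsWithin_le_nhds
  have hreg : ∀ᶠ s in nhdsWithin 0 (Set.Ioi 0), p s ∈ regularSet P := by
    refine Filter.eventually_all.2 fun k => ?_
    change ∀ᶠ s in nhdsWithin 0 (Set.Ioi 0), expRoot (p s) k ≠ 1
    by_cases hk : f (P.root k) = 0
    · filter_upwards [eventually_exp_ne_one (hpar' k (hpar k hk)).2.1 0] with s hs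
      simpa [hE, hk] using hs
    · exact ((hcont k).eventually_ne (hout k hk)).filter_mono nhdsWithin_le_nhds
  have hlimZ : ∀ k, Filter.Tendsto
      (fun s : ℝ => (s : ℂ) * (1 / 2 * (cothHalf (expRoot (p s) k) * rootEval k Z)))
      (nhdsWithin 0 (Set.Ioi 0))
      (nhds (if k = i ∨ P.root k = -P.root i then 1 / 2 else 0)) := by
    intro k
    by_cases hk : k = i ∨ P.root k = -P.root i
    · obtain ⟨hk1, hne, -⟩ := hpar' k hk
      have h1 := (tendsto_mul_cothHalf_exp hne 0).mul_const (1 / 2 * rootEval k Z)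
      rw [hZ] at h1 ⊢
      rw [if_pos hk]
      have h2 : ((h (P.root k) : ℝ) : ℂ)⁻¹ * (1 / 2 * ((h (P.root k) : ℝ) : ℂ)) = 1 / 2 := by
        field_simp
      rw [h2] at h1
      refine h1.congr fun s => ?_
      rw [hE, hk1, Complex.ofReal_zero, zero_add, mul_zero, add_zero]
      ring
    · rw [if_neg hk]
      have h1 := (tendsto_ofReal_zero.mul (hlimout k fun h => hk (hpar k h))).mul_const
        (1 / 2 * rootEval k Z)
      simp only [zero_mul] at h1
      refine h1.congr fun s => ?_
      ring
  have hlimv : ∀ k, Filter.Tendsto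
      (fun s : ℝ => 1 / 2 * (cothHalf (expRoot (p s) k) * rootEval k v))
      (nhdsWithin 0 (Set.Ioi 0))
      (nhds (1 / 2 * (cothHalf (Complex.exp (f (P.root k) : ℝ)) * rootEval k v))) := by
    intro k
    by_cases hk : f (P.root k) = 0
    · simp [(hpar' k (hpar k hk)).2.2]
    · have h1 := hlimout k hk
      rw [hE0] at h1
      exact (h1.mul_const _).const_mul _
  have hfin := lie_eq_of_tendsto (l := nhdsWithin (0 : ℝ) (Set.Ioi 0)) t (delta b t τ Z)
    (delta b t τ v) 0 hlimZ hlimv (r := fun s : ℝ => (s : ℂ) * 1) (r' := fun _ : ℝ => 1)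
    (r₀ := 0) (r₀' := 1)
    (by simpa using tendsto_ofReal_zero) tendsto_const_nhds (by
      filter_upwards [hreg] with s hs
      have h1 := H (p s) hs Z v
      rw [posForm_trig_eq_sum_univ b ht τ hs, posForm_trig_eq_sum_univ b ht τ hs] at h1
      simp only [mul_smul (Complex.ofReal s), ← Finset.smul_sum, ← smul_add]
      rw [lie_eq_lieBilin, LinearMap.map_smul₂, ← lie_eq_lieBilin, h1, smul_zero])
  rw [sum_parallel_smul ht, zero_smul, add_zero, one_smul, lie_eq_lieBilin, map_add,
    map_sum] at hfin
  -- The coefficients left in the limit of ω(v) are constant on α-strings, since both f and v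
  -- annihilate α.
  have hres := lie_sum_eq_zero_of_string ht hS i
    (fun k => 1 / 2 * (cothHalf (Complex.exp (f (P.root k) : ℝ)) * rootEval k v)) (by
      rintro j k - - ⟨n, hn⟩
      simp only [rootEval_add_zsmul hn, hv, hn, map_add, map_zsmul, hfi, smul_zero, add_zero,
        mul_zero])
  simp only [map_smul] at hfin
  simp only [lie_eq_lieBilin] at hres
  rw [hres, zero_add] at hfin
  exact hfin

end RelationsOfFlat

end TrigConnection

/-! ### The theorem. -/

open TrigConnection in
theorem mainTheorem2 {ι M N A : Type*} [Fintype ι]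
    [AddCommGroup M] [Module ℝ M] [AddCommGroup N] [Module ℝ N]
    (P : RootPairing ι ℝ M N) [P.IsRootSystem] [P.IsCrystallographic] [P.IsReduced]
    (b : P.Base) [Ring A] [Algebra ℂ A]
    (t : ι → A) (ht : ∀ i j, P.root j = -P.root i → t j = t i)
    (τ : TrigConnection.Cartan P →ₗ[ℂ] A) :
    (TrigConnection.IsFlatOn (TrigConnection.trigForm b t τ) (TrigConnection.regularSet P) ↔
      TrigConnection.RelTT b t ∧ TrigConnection.RelTauTau τ ∧ TrigConnection.RelTTau b t τ) ∧
    (TrigConnection.RelTT b t →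
      (TrigConnection.RelTTau b t τ ↔ TrigConnection.RelTDelta b t τ)) := by
  rw [isFlatOn_iff, relTT_iff_relString b ht]
  refine ⟨⟨fun H => ?_, ?_⟩, fun hS => relTTau_iff_relTDelta b ht hS τ⟩
  · have hS : RelString P t := relString_of_relPlane P ht (relPlane_of_flat b ht H)
    have hδ : RelTDelta b t τ := relTDelta_of_flat b ht H hS
    refine ⟨hS, fun u v => ?_, (relTTau_iff_relTDelta b ht hS τ).2 hδ⟩
    -- The bracket equals [τ(u), τ(v)] at every regular point, so one such point gives (ττ).
    obtain ⟨p, hp⟩ := regularSet_nonempty b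
    rw [← lie_trigForm b ht hS hδ hp, H p hp]
  · rintro ⟨hS, hττ, htτ⟩ p hp u v
    rw [lie_trigForm b ht hS ((relTTau_iff_relTDelta b ht hS τ).1 htτ) hp, hττ]

end
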